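/- For a unital subhomogeneous C*-algebra $A$ (that is, the dimensions of the irreducible representations of $A$ are finite and bounded) let $\mathrm{Prim}_d(A)$ be the set of the kernels of the $d$-dimensional irreducible representations of $A$, with the topology induced by the hull-kernel topology of the primitive ideal space of $A$, and put $$\mathrm{dimRatio}(A)=\max_d \frac{\dim(\mathrm{Prim}_d(A))}{d}\in[0,\infty],$$ where $d$ runs over the dimensions of the irreducible representations of $A$ and $\dim$ is the topological covering dimension (if $A=0$, put $\mathrm{dimRatio}(A)=0$). Let $C$ and $S$ be separable unital subhomogeneous C*-algebras, and let $J\geq 1$ be a natural number such that each irreducible representation of $C$ or $S$ has dimension at least $J$. Let $C\otimes S$ be their (spatial) C*-algebra tensor product. Then $C\otimes S$ is subhomogeneous, and $$\mathrm{dimRatio}(C\otimes S)\leq \frac{\mathrm{dimRatio}(C)+\mathrm{dimRatio}(S)}{J}.$$ -/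

import Mathlib

open scoped TensorProduct ComplexOrder ENNReal

universe u v

noncomputable section

/-! ### Topological covering dimension -/

/-- `dim X ≤ n`: every finite open cover of `X` has a finite open refinement (covering `X`) such
that every point lies in at most `n + 1` of its members. -/
def CoveringDimLE (X : Type*) [TopologicalSpace X] (n : ℕ) : Prop :=
  ∀ 𝒰 : Set (Set X), 𝒰.Finite → (∀ U ∈ 𝒰, IsOpen U) → ⋃₀ 𝒰 = Set.univ →
    ∃ 𝒱 : Set (Set X), 𝒱.Finite ∧ (∀ V ∈ 𝒱, IsOpen V) ∧ ⋃₀ 𝒱 = Set.univ ∧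
      (∀ V ∈ 𝒱, ∃ U ∈ 𝒰, V ⊆ U) ∧ ∀ x : X, {V ∈ 𝒱 | x ∈ V}.encard ≤ n + 1

/-- The covering dimension of a nonempty space, with value `⊤` if it is infinite. (It is used for
nonempty spaces only, so the convention `dim ∅ = -1` plays no role.) -/
def coveringDim (X : Type*) [TopologicalSpace X] : ℕ∞ :=
  ⨅ (n : ℕ) (_ : CoveringDimLE X n), (n : ℕ∞)

/-! ### Irreducible representations and the primitive spectrum -/

/-- A (unital) `*`-representation on a Hilbert space is irreducible if the space is nonzero and has
no closed invariant subspaces other than the trivial ones. -/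
structure IsIrreducibleRep {A : Type*} [CStarAlgebra A] {H : Type*} [NormedAddCommGroup H]
    [InnerProductSpace ℂ H] [CompleteSpace H] (π : A →⋆ₐ[ℂ] (H →L[ℂ] H)) : Prop where
  nontrivial : Nontrivial H
  eq_bot_or_eq_top : ∀ M : Submodule ℂ H, IsClosed (M : Set H) →
    (∀ a : A, ∀ x ∈ M, π a x ∈ M) → M = ⊥ ∨ M = ⊤

/-- A C⋆-algebra is subhomogeneous if the dimensions of its irreducible representations are finite
and bounded. (Every irreducible representation of `A` is equivalent to one on a Hilbert space in
the universe of `A`, by the GNS construction.) -/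
def IsSubhomogeneous (A : Type u) [CStarAlgebra A] : Prop :=
  ∃ N : ℕ, ∀ (H : Type u) [NormedAddCommGroup H] [InnerProductSpace ℂ H] [CompleteSpace H]
    (π : A →⋆ₐ[ℂ] (H →L[ℂ] H)), IsIrreducibleRep π →
      FiniteDimensional ℂ H ∧ Module.finrank ℂ H ≤ N

/-- Every irreducible representation of `A` has dimension at least `J`. -/
def IrrepsDimGE (A : Type u) [CStarAlgebra A] (J : ℕ) : Prop :=
  ∀ (H : Type u) [NormedAddCommGroup H] [InnerProductSpace ℂ H] [CompleteSpace H]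
    (π : A →⋆ₐ[ℂ] (H →L[ℂ] H)), IsIrreducibleRep π → (J : Cardinal) ≤ Module.rank ℂ H

/-- A primitive ideal is the kernel of an irreducible representation. -/
def IsPrimitiveIdeal {A : Type u} [CStarAlgebra A] (P : Ideal A) : Prop :=
  ∃ (H : Type u) (_ : NormedAddCommGroup H) (_ : InnerProductSpace ℂ H) (_ : CompleteSpace H)
    (π : A →⋆ₐ[ℂ] (H →L[ℂ] H)), IsIrreducibleRep π ∧ RingHom.ker π = P

/-- The primitive spectrum `Prim A`. -/
def PrimitiveSpectrum (A : Type u) [CStarAlgebra A] : Type u :=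
  {P : Ideal A // IsPrimitiveIdeal P}

/-- Primitive ideals are prime: if `a` and `b` lie outside `P`, then so does `a * c * b` for
some `c`. -/
theorem IsPrimitiveIdeal.exists_mul_mul_notMem {A : Type u} [CStarAlgebra A] {P : Ideal A}
    (hP : IsPrimitiveIdeal P) {a b : A} (ha : a ∉ P) (hb : b ∉ P) : ∃ c : A, a * c * b ∉ P := by
  obtain ⟨H, _, _, _, π, hπ, rfl⟩ := hP
  by_contra! h
  simp only [RingHom.mem_ker] at ha hb h
  obtain ⟨y, hy⟩ : ∃ y, π b y ≠ 0 := by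
    by_contra! h0
    exact hb (ContinuousLinearMap.ext h0)
  let M : Submodule ℂ H :=
    { carrier := {x | ∀ c : A, π a (π c x) = 0}
      add_mem' := fun hx hx' c => by simp [hx c, hx' c]
      zero_mem' := fun c => by simp
      smul_mem' := fun r x hx c => by simp [hx c] }
  have hcl : IsClosed (M : Set H) := by
    have : (M : Set H) = ⋂ c : A, {x | π a (π c x) = 0} := by
      ext x; simp [M]
    rw [this]
    exact isClosed_iInter fun c => isClosed_eq (by fun_prop) continuous_const
  have hinv : ∀ d : A, ∀ x ∈ M, π d x ∈ M := by
    intro d x hx c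
    have := hx (c * d)
    simpa [map_mul] using this
  have hyM : π b y ∈ M := by
    intro c
    have := congrArg (fun T : H →L[ℂ] H => T y) (h c)
    simpa [map_mul] using this
  rcases hπ.eq_bot_or_eq_top M hcl hinv with hM | hM
  · rw [hM, Submodule.mem_bot] at hyM
    exact hy hyM
  · apply ha
    ext x
    have hx : x ∈ M := by rw [hM]; trivial
    simpa using hx 1

/-- The hull-kernel (Jacobson) topology: the closed sets are the hulls `{P | F ⊆ P}` of subsets
(equivalently, of ideals) `F` of `A`. -/
instance (A : Type u) [CStarAlgebra A] : TopologicalSpace (PrimitiveSpectrum A) where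
  IsOpen U := ∃ F : Set A, U = {P | ∃ a ∈ F, a ∉ P.1}
  isOpen_univ := ⟨{1}, by
    symm
    rw [Set.eq_univ_iff_forall]
    rintro ⟨P, H, _, _, _, π, hπ, rfl⟩
    refine ⟨1, rfl, ?_⟩
    have := hπ.nontrivial
    simp [RingHom.mem_ker]⟩
  isOpen_inter := by
    rintro _ _ ⟨F, rfl⟩ ⟨G, rfl⟩
    refine ⟨{x | ∃ a ∈ F, ∃ b ∈ G, ∃ c, x = a * c * b}, ?_⟩
    ext P
    constructor
    · rintro ⟨⟨a, ha, haP⟩, ⟨b, hb, hbP⟩⟩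
      obtain ⟨c, hc⟩ := P.2.exists_mul_mul_notMem haP hbP
      exact ⟨_, ⟨a, ha, b, hb, c, rfl⟩, hc⟩
    · rintro ⟨_, ⟨a, ha, b, hb, c, rfl⟩, hc⟩
      refine ⟨⟨a, ha, fun h => hc ?_⟩, ⟨b, hb, fun h => hc (P.1.mul_mem_left _ h)⟩⟩
      obtain ⟨P, H, _, _, _, π, hπ, rfl⟩ := P
      simp only [RingHom.mem_ker] at h ⊢
      simp [map_mul, h]
  isOpen_sUnion := by
    intro 𝒮 h
    refine ⟨{a | {P : PrimitiveSpectrum A | a ∉ P.1} ⊆ ⋃₀ 𝒮}, ?_⟩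
    ext P
    constructor
    · rintro ⟨U, hU, hP⟩
      obtain ⟨F, rfl⟩ := h U hU
      obtain ⟨a, ha, haP⟩ := hP
      exact ⟨a, fun Q hQ => ⟨_, hU, a, ha, hQ⟩, haP⟩
    · rintro ⟨a, ha, haP⟩
      exact ha haP

/-- `Prim_d A`: the primitive ideals that are kernels of `d`-dimensional irreducible
representations. As a space it carries the topology induced by `Prim A`. -/
def primOfDim (A : Type u) [CStarAlgebra A] (d : ℕ) : Set (PrimitiveSpectrum A) :=
  {P | ∃ (H : Type u) (_ : NormedAddCommGroup H) (_ : InnerProductSpace ℂ H) (_ : CompleteSpace H)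
    (π : A →⋆ₐ[ℂ] (H →L[ℂ] H)), IsIrreducibleRep π ∧ FiniteDimensional ℂ H ∧
      Module.finrank ℂ H = d ∧ RingHom.ker π = P.1}

/-- The dimension ratio of a subhomogeneous C⋆-algebra: the maximum of `dim (Prim_d A) / d` over the
dimensions `d` of the irreducible representations of `A`. -/
def dimRatio (A : Type u) [CStarAlgebra A] : ℝ≥0∞ :=
  ⨆ (d : ℕ) (_ : (primOfDim A d).Nonempty), (coveringDim (primOfDim A d) : ℝ≥0∞) / d

/-! ### The (spatial) tensor product of unital C⋆-algebras -/

/-- The states of `A`, i.e. the positive linear functionals `φ` with `φ 1 = 1`; here `A` carries its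
usual order, for which the positive elements are the self-adjoint ones with spectrum in `[0, ∞)`. -/
def CStarState (A : Type u) [CStarAlgebra A] : Type u :=
  letI := CStarAlgebra.spectralOrder A
  {φ : A →ₚ[ℂ] ℂ // φ 1 = 1}

namespace CStarState

variable {A : Type u} [CStarAlgebra A]

/-- The Hilbert space of the GNS representation of a state. -/
def Space (φ : CStarState A) : Type u :=
  letI := CStarAlgebra.spectralOrder A
  haveI := CStarAlgebra.spectralOrderedRing A
  φ.1.GNS

instance (φ : CStarState A) : NormedAddCommGroup φ.Space :=
  letI := CStarAlgebra.spectralOrder A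
  haveI := CStarAlgebra.spectralOrderedRing A
  inferInstanceAs (NormedAddCommGroup φ.1.GNS)

instance (φ : CStarState A) : InnerProductSpace ℂ φ.Space :=
  letI := CStarAlgebra.spectralOrder A
  haveI := CStarAlgebra.spectralOrderedRing A
  inferInstanceAs (InnerProductSpace ℂ φ.1.GNS)

instance (φ : CStarState A) : CompleteSpace φ.Space :=
  letI := CStarAlgebra.spectralOrder A
  haveI := CStarAlgebra.spectralOrderedRing A
  inferInstanceAs (CompleteSpace φ.1.GNS)

/-- The GNS representation of a state. -/
def rep (φ : CStarState A) : A →⋆ₐ[ℂ] (φ.Space →L[ℂ] φ.Space) :=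
  letI := CStarAlgebra.spectralOrder A
  haveI := CStarAlgebra.spectralOrderedRing A
  φ.1.gnsStarAlgHom

instance (φ : CStarState A) : Nontrivial φ.Space := by
  let _ := CStarAlgebra.spectralOrder A
  have := CStarAlgebra.spectralOrderedRing A
  refine ⟨⟨((φ.1.toPreGNS 1 : φ.1.PreGNS) : φ.1.GNS), (0 : φ.1.GNS), fun h => ?_⟩⟩
  have h1 := congrArg (fun x : φ.1.GNS => ‖x‖) h
  simp only [UniformSpace.Completion.norm_coe, norm_zero] at h1
  have h2 := φ.1.preGNS_norm_sq (φ.1.toPreGNS 1)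
  rw [h1] at h2
  simp [φ.2] at h2

end CStarState

/-- The tensor product of two Hilbert spaces. -/
abbrev HilbertTensor (H : Type*) (K : Type*) [NormedAddCommGroup H] [InnerProductSpace ℂ H]
    [NormedAddCommGroup K] [InnerProductSpace ℂ K] : Type _ :=
  UniformSpace.Completion (H ⊗[ℂ] K)

/-- The tensor product `T ⊗ U` of two bounded operators, as an operator on the Hilbert space
tensor product. -/
def opTensor {H : Type*} {K : Type*} [NormedAddCommGroup H] [InnerProductSpace ℂ H]
    [NormedAddCommGroup K] [InnerProductSpace ℂ K] (T : H →L[ℂ] H) (U : K →L[ℂ] K) :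
    HilbertTensor H K →L[ℂ] HilbertTensor H K :=
  (TensorProduct.mapL T U).completion

instance (H : Type*) (K : Type*) [NormedAddCommGroup H] [InnerProductSpace ℂ H]
    [NormedAddCommGroup K] [InnerProductSpace ℂ K] [Nontrivial H] [Nontrivial K] :
    Nontrivial (HilbertTensor H K) := by
  obtain ⟨x, hx⟩ := exists_ne (0 : H)
  obtain ⟨y, hy⟩ := exists_ne (0 : K)
  refine ⟨⟨((x ⊗ₜ[ℂ] y : H ⊗[ℂ] K) : HilbertTensor H K), 0, fun h => ?_⟩⟩
  have := congrArg norm h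
  simp [hx, hy] at this

theorem norm_opTensor_le {H : Type*} {K : Type*} [NormedAddCommGroup H] [InnerProductSpace ℂ H]
    [NormedAddCommGroup K] [InnerProductSpace ℂ K] (T : H →L[ℂ] H) (U : K →L[ℂ] K) :
    ‖opTensor T U‖ ≤ ‖T‖ * ‖U‖ := by
  refine ContinuousLinearMap.opNorm_le_bound _ (by positivity) fun x => ?_
  induction x using UniformSpace.Completion.induction_on with
  | hp => exact isClosed_le (by fun_prop) (by fun_prop)
  | ih x =>
    simp only [opTensor, ContinuousLinearMap.completion_apply_coe, UniformSpace.Completion.norm_coe]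
    exact (ContinuousLinearMap.le_opNorm _ _).trans
      (mul_le_mul_of_nonneg_right (TensorProduct.norm_mapL_le T U) (norm_nonneg _))

/-- The `ℓ^∞`-product of a family of C⋆-algebras, with its pointwise operations and the supremum
norm, is a C⋆-algebra. -/
@[reducible] def cstarAlgebraLpInfty {I : Type*} (A : I → Type*) [∀ i, CStarAlgebra (A i)]
    [∀ i, Nontrivial (A i)] : CStarAlgebra (lp A ∞) where

/-- The C⋆-algebra of bounded operators on the tensor product of the GNS spaces of two states. -/
def GNSTensorOp {C : Type u} {S : Type v} [CStarAlgebra C] [CStarAlgebra S] (φ : CStarState C)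
    (ψ : CStarState S) : Type (max u v) :=
  HilbertTensor φ.Space ψ.Space →L[ℂ] HilbertTensor φ.Space ψ.Space

instance {C : Type u} {S : Type v} [CStarAlgebra C] [CStarAlgebra S] (φ : CStarState C)
    (ψ : CStarState S) : CStarAlgebra (GNSTensorOp φ ψ) :=
  inferInstanceAs
    (CStarAlgebra (HilbertTensor φ.Space ψ.Space →L[ℂ] HilbertTensor φ.Space ψ.Space))

instance {C : Type u} {S : Type v} [CStarAlgebra C] [CStarAlgebra S] (φ : CStarState C)
    (ψ : CStarState S) : Nontrivial (GNSTensorOp φ ψ) :=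
  inferInstanceAs (Nontrivial (HilbertTensor φ.Space ψ.Space →L[ℂ] HilbertTensor φ.Space ψ.Space))

/-- The C⋆-algebra of all bounded families `(T φ ψ)` with `T φ ψ` an operator on the tensor product
of the GNS spaces of the states `φ` of `C` and `ψ` of `S`. -/
abbrev GNSTensorProd (C : Type u) (S : Type v) [CStarAlgebra C] [CStarAlgebra S] : Type (max u v) :=
  lp (fun p : CStarState C × CStarState S => GNSTensorOp p.1 p.2) ∞

instance (C : Type u) (S : Type v) [CStarAlgebra C] [CStarAlgebra S] :
    CStarAlgebra (GNSTensorProd C S) :=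
  cstarAlgebraLpInfty _

/-- The elementary tensor `c ⊗ s`, acting as `π_φ(c) ⊗ π_ψ(s)` for all states `φ` and `ψ`. -/
def elemTensor {C : Type u} {S : Type v} [CStarAlgebra C] [CStarAlgebra S] (c : C) (s : S) :
    GNSTensorProd C S :=
  ⟨fun p => opTensor (p.1.rep c) (p.2.rep s), memℓp_infty ⟨‖c‖ * ‖s‖, by
    rintro _ ⟨p, rfl⟩
    exact (norm_opTensor_le _ _).trans (mul_le_mul (NonUnitalStarAlgHom.norm_apply_le _ c)
      (NonUnitalStarAlgHom.norm_apply_le _ s) (norm_nonneg _) (norm_nonneg _))⟩⟩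

/-- The elementary tensors generate the spatial tensor product as a C⋆-algebra. -/
def spatialTensor (C : Type u) (S : Type v) [CStarAlgebra C] [CStarAlgebra S] :
    StarSubalgebra ℂ (GNSTensorProd C S) :=
  (StarAlgebra.adjoin ℂ {x | ∃ (c : C) (s : S), x = elemTensor c s}).topologicalClosure

/-- The tensor product `C ⊗ S` of unital C⋆-algebras: the completion of the algebraic tensor product
in the spatial (minimal) norm `‖x‖ = sup ‖(π_φ ⊗ π_ψ)(x)‖` over the GNS representations of the states
`φ` of `C` and `ψ` of `S`, that is, the C⋆-algebra generated by the elementary tensors in the tensor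
product of the universal representations. -/
def CStarTensor (C : Type u) (S : Type v) [CStarAlgebra C] [CStarAlgebra S] : Type (max u v) :=
  spatialTensor C S

instance (C : Type u) (S : Type v) [CStarAlgebra C] [CStarAlgebra S] :
    CStarAlgebra (CStarTensor C S) :=
  StarSubalgebra.cstarAlgebra (spatialTensor C S)
    (h_closed := StarSubalgebra.isClosed_topologicalClosure _)

end

universe w

noncomputable section

/-! ### Dimension theory -/

section CoveringDimension

open Set

/-! The algebraic half identifies the irreducible representations of `C ⊗ S`. If `σ` is one, then
its restrictions to `C ⊗ 1` and `1 ⊗ S` are factor representations, since each commutes with the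
other. The kernel of a factor representation is prime. For a subhomogeneous algebra this forces it
to contain, and in fact equal, the kernel of a finite-dimensional irreducible representation
(`IsFactorRep.exists_surjective`). So `σ` has the kernel of some `z ⊗ w` with `z`, `w` irreducible
of dimensions `k`, `l`, and `dim σ = k * l` (`IsIrreducibleRep.exists_tensor`). This gives
subhomogeneity, and as a set `Prim_d (C ⊗ S)` is the disjoint union of the products `Prim_k C ×
Prim_l S` over `k * l = d`.

The topological half turns this into an estimate of dimensions. `Prim_d A` is the image, under a
proper map, of the surjective representations on one fixed `d`-dimensional space, an open subset of
a compact Hausdorff space (`irrSpace.isProperMap_toPrim`). Hence it is Hausdorff and locally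
compact, and σ-compact for separable `A`. The injections `Φ` of `Prim_k C × Prim_l S` into `Prim_d
(C ⊗ S)` are continuous, so they restrict to homeomorphisms from compact sets onto closed sets. The
product theorem for compact spaces (`CoveringDimLE.prod`) and the countable closed sum theorem
(`CoveringDimLE.of_iUnion`) bound `dim Prim_d (C ⊗ S)` by the largest `dim Prim_k C + dim Prim_l S`
with `k * l = d`.

The inequality is then arithmetic: `(a + b) / (k * l) = (a / k) / l + (b / l) / k`, and `k, l ≥ J`.
-/

/-- Merging all members of a refinement that are assigned to the same `U i` does not increase the
multiplicity at any point, so a refinement may keep the index set of the cover. -/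
theorem CoveringDimLE.exists_refinement {X ι : Type*} [TopologicalSpace X] [Finite ι] {n : ℕ}
    (h : CoveringDimLE X n) {U : ι → Set X} (hU : ∀ i, IsOpen (U i)) (hc : ⋃ i, U i = univ) :
    ∃ V : ι → Set X, (∀ i, IsOpen (V i)) ∧ ⋃ i, V i = univ ∧ (∀ i, V i ⊆ U i) ∧
      ∀ x, {i | x ∈ V i}.encard ≤ n + 1 := by
  obtain ⟨𝒱, -, h𝒱o, h𝒱c, h𝒱r, h𝒱n⟩ := h (range U) (finite_range U)
    (by rintro _ ⟨i, rfl⟩; exact hU i) (by rw [sUnion_range, hc])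
  have hr : ∀ V : 𝒱, ∃ i, V.1 ⊆ U i := fun V => by
    obtain ⟨_, ⟨i, rfl⟩, hi⟩ := h𝒱r V V.2
    exact ⟨i, hi⟩
  choose f hf using hr
  refine ⟨fun i => ⋃ V : {V : 𝒱 // f V = i}, V.1.1, fun i => isOpen_iUnion fun V => h𝒱o _ V.1.2,
    ?_, fun i => iUnion_subset fun V => by have := hf V.1; rwa [V.2] at this, fun x => ?_⟩
  · refine eq_univ_of_forall fun x => ?_
    obtain ⟨V, hV, hx⟩ : x ∈ ⋃₀ 𝒱 := h𝒱c ▸ mem_univ x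
    exact mem_iUnion.2 ⟨f ⟨V, hV⟩, mem_iUnion.2 ⟨⟨⟨V, hV⟩, rfl⟩, hx⟩⟩
  · have h1 : {i | x ∈ ⋃ V : {V : 𝒱 // f V = i}, V.1.1} ⊆ f '' {V : 𝒱 | x ∈ V.1} := by
      intro i hi
      obtain ⟨⟨V, hV⟩, hx⟩ := mem_iUnion.1 hi
      exact ⟨V, hx, hV⟩
    have h2 : Subtype.val '' {V : 𝒱 | x ∈ V.1} = {V ∈ 𝒱 | x ∈ V} := by
      ext V; simp [and_comm]
    calc _ ≤ _ := encard_le_encard h1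
      _ ≤ {V : 𝒱 | x ∈ V.1}.encard := encard_image_le _ _
      _ = {V ∈ 𝒱 | x ∈ V}.encard := by
        rw [← h2, Subtype.val_injective.encard_image]
      _ ≤ n + 1 := h𝒱n x

/-- It suffices to refine each indexed finite cover by a finite indexed cover. -/
theorem CoveringDimLE.of_forall_exists {X : Type u} [TopologicalSpace X] {n : ℕ}
    (h : ∀ (ι : Type u) [Finite ι] (U : ι → Set X), (∀ i, IsOpen (U i)) → ⋃ i, U i = univ →
      ∃ (κ : Type u) (_ : Finite κ) (V : κ → Set X), (∀ j, IsOpen (V j)) ∧ ⋃ j, V j = univ ∧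
        (∀ j, ∃ i, V j ⊆ U i) ∧ ∀ x, {j | x ∈ V j}.encard ≤ n + 1) :
    CoveringDimLE X n := by
  intro 𝒰 hfin hop hcov
  have := hfin.to_subtype
  obtain ⟨κ, _, V, hVo, hVc, hVr, hVn⟩ := h 𝒰 (fun U => U.1) (fun U => hop _ U.2)
    (by rw [← sUnion_eq_iUnion, hcov])
  refine ⟨range V, finite_range V, by rintro _ ⟨i, rfl⟩; exact hVo i, by rw [sUnion_range, hVc], ?_,
    fun x => ?_⟩
  · rintro _ ⟨j, rfl⟩
    obtain ⟨U, hU⟩ := hVr j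
    exact ⟨U, U.2, hU⟩
  · refine le_trans (encard_le_encard (t := V '' {j | x ∈ V j}) ?_)
      ((encard_image_le _ _).trans (hVn x))
    rintro _ ⟨⟨j, rfl⟩, hj⟩
    exact ⟨j, hj, rfl⟩

/-- Covering dimension is monotone under closed embeddings. -/
theorem CoveringDimLE.of_isClosedEmbedding {X : Type u} {Y : Type*} [TopologicalSpace X]
    [TopologicalSpace Y] {f : X → Y} (hf : Topology.IsClosedEmbedding f) {n : ℕ}
    (h : CoveringDimLE Y n) : CoveringDimLE X n := by
  refine .of_forall_exists fun ι _ U hU hc => ?_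
  choose O hO hOU using fun i => hf.isInducing.isOpen_iff.1 (hU i)
  -- The complement of the range is the extra member `none`; it completes the cover of `Y` and
  -- disappears on pulling back to `X`.
  obtain ⟨V, hVo, hVc, hVO, hVn⟩ := h.exists_refinement (U := fun i : Option ι =>
      i.elim (range f)ᶜ O) (by
      rintro (_ | i)
      · exact hf.isClosed_range.isOpen_compl
      · exact hO i) (by
      refine eq_univ_of_forall fun y => ?_
      by_cases hy : y ∈ range f
      · obtain ⟨x, rfl⟩ := hy
        obtain ⟨i, hi⟩ := mem_iUnion.1 (hc ▸ mem_univ x : x ∈ ⋃ i, U i)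
        exact mem_iUnion.2 ⟨some i, by rw [← hOU i] at hi; exact hi⟩
      · exact mem_iUnion.2 ⟨none, hy⟩)
  refine ⟨ι, inferInstance, fun i => f ⁻¹' V (some i), fun i => (hVo _).preimage hf.continuous, ?_,
    fun i => ⟨i, by rw [← hOU i]; exact preimage_mono (hVO (some i))⟩, fun x => ?_⟩
  · refine eq_univ_of_forall fun x => ?_
    obtain ⟨i, hi⟩ := mem_iUnion.1 (hVc ▸ mem_univ (f x) : f x ∈ ⋃ i, V i)
    cases i with
    | none => exact absurd (mem_range_self x) (hVO none hi)
    | some i => exact mem_iUnion.2 ⟨i, hi⟩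
  · refine le_trans ?_ (hVn (f x))
    rw [← (Option.some_injective ι).encard_image]
    refine encard_le_encard ?_
    rintro _ ⟨i, hi, rfl⟩
    exact hi

theorem CoveringDimLE.mono {X : Type*} [TopologicalSpace X] {m n : ℕ} (h : CoveringDimLE X m)
    (hmn : m ≤ n) : CoveringDimLE X n := by
  intro 𝒰 h1 h2 h3
  obtain ⟨𝒱, a, b, c, d, e⟩ := h 𝒰 h1 h2 h3
  exact ⟨𝒱, a, b, c, d, fun x => (e x).trans (by gcongr)⟩

theorem coveringDimLE_of_coveringDim_eq {X : Type*} [TopologicalSpace X] {n : ℕ}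
    (h : coveringDim X = n) : CoveringDimLE X n := by
  by_contra hn
  have : ((n + 1 : ℕ) : ℕ∞) ≤ coveringDim X := le_iInf₂ fun m hm => by
    by_contra! hlt
    have : m < n + 1 := by exact_mod_cast hlt
    exact hn (hm.mono (by omega))
  rw [h] at this
  have : n + 1 ≤ n := by exact_mod_cast this
  omega

/-- Finite closed families in a normal space can be enlarged to open families without creating
new `k`-fold intersections. -/
theorem exists_open_swelling {X ι : Type*} [TopologicalSpace X] [NormalSpace X] [Finite ι]
    {E U : ι → Set X} (hE : ∀ i, IsClosed (E i)) (hU : ∀ i, IsOpen (U i)) (hEU : ∀ i, E i ⊆ U i)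
    {n : ℕ} (hn : ∀ x, {i | x ∈ E i}.encard ≤ n) :
    ∃ V : ι → Set X, (∀ i, IsOpen (V i)) ∧ (∀ i, E i ⊆ V i) ∧ (∀ i, V i ⊆ U i) ∧
      ∀ x, {i | x ∈ V i}.encard ≤ n := by
  -- For more than `n` indices the sets `E i` have empty intersection, so their complements cover.
  -- Shrinking this cover to closed sets and taking complements again gives open swellings that
  -- still have empty intersection. The set `V i` is then `U i` intersected with the swellings
  -- belonging to all `s` that contain `i`.
  have key : ∀ s : {s : Set ι // ((n + 1 : ℕ) : ℕ∞) ≤ s.encard}, ∃ W : s.1 → Set X,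
      (∀ i, IsOpen (W i)) ∧ (∀ i : s.1, E i ⊆ W i) ∧ ⋂ i, W i = ∅ := by
    rintro ⟨s, hs⟩
    obtain ⟨v, hv1, hv2, hv3⟩ := exists_iUnion_eq_closed_subset (u := fun i : s => (E i)ᶜ)
      (fun i => (hE i).isOpen_compl) (fun x => toFinite _) (by
        refine eq_univ_of_forall fun x => ?_
        by_contra hx
        simp only [mem_iUnion, mem_compl_iff, not_exists, not_not, Subtype.forall] at hx
        have h1 : ((n + 1 : ℕ) : ℕ∞) ≤ n :=
          hs.trans ((encard_le_encard fun i hi => hx i hi).trans (hn x))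
        have h2 : n + 1 ≤ n := by exact_mod_cast h1
        omega)
    refine ⟨fun i => (v i)ᶜ, fun i => (hv2 i).isOpen_compl,
      fun i => subset_compl_comm.1 (hv3 i), ?_⟩
    rw [← compl_iUnion, hv1, compl_univ]
  choose W hW1 hW2 hW3 using key
  refine ⟨fun i => U i ∩ ⋂ (s) (hi : i ∈ s.1), W s ⟨i, hi⟩,
    fun i => (hU i).inter (isOpen_iInter_of_finite fun s => isOpen_iInter_of_finite fun hi =>
      hW1 _ _), fun i => subset_inter (hEU i) (subset_iInter₂ fun s hi => hW2 s ⟨i, hi⟩),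
    fun i => inter_subset_left, fun x => ?_⟩
  by_contra! hlt
  let s : {s : Set ι // ((n + 1 : ℕ) : ℕ∞) ≤ s.encard} :=
    ⟨_, by rw [Nat.cast_add, Nat.cast_one]; exact Order.add_one_le_of_lt hlt⟩
  have : x ∈ ⋂ i, W s i := mem_iInter.2 fun i => mem_iInter₂.1 i.2.2 s i.2
  simp [hW3] at this

/-- One step of the sum theorem: a refinement on `F` extends to the whole space by adding `Fᶜ` to
each member, and normality shrinks the result so that the multiplicity bound on `F` holds even for
closures. -/
theorem CoveringDimLE.exists_shrinking {X ι : Type*} [TopologicalSpace X] [NormalSpace X] [Finite ι]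
    {F : Set X} (hF : IsClosed F) {n : ℕ} (h : CoveringDimLE F n) {U : ι → Set X}
    (hU : ∀ i, IsOpen (U i)) (hc : ⋃ i, U i = univ) :
    ∃ V : ι → Set X, (∀ i, IsOpen (V i)) ∧ ⋃ i, V i = univ ∧ (∀ i, closure (V i) ⊆ U i) ∧
      ∀ x ∈ F, {i | x ∈ closure (V i)}.encard ≤ n + 1 := by
  obtain ⟨W, hW1, hW2, hW3, hW4⟩ := h.exists_refinement (U := fun i => (↑) ⁻¹' U i)
    (fun i => (hU i).preimage continuous_subtype_val) (by rw [← preimage_iUnion, hc, preimage_univ])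
  choose O hO hOW using fun i => isOpen_induced_iff.1 (hW1 i)
  obtain ⟨V, hV1, hV2, hV3⟩ := exists_iUnion_eq_closure_subset (u := fun i => U i ∩ (O i ∪ Fᶜ))
    (fun i => (hU i).inter ((hO i).union hF.isOpen_compl)) (fun x => toFinite _) (by
      refine eq_univ_of_forall fun x => ?_
      by_cases hx : x ∈ F
      · obtain ⟨i, hi⟩ := mem_iUnion.1 (hW2 ▸ mem_univ (⟨x, hx⟩ : F) : _ ∈ ⋃ i, W i)
        exact mem_iUnion.2 ⟨i, hW3 i hi, Or.inl (by rw [← hOW i] at hi; exact hi)⟩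
      · obtain ⟨i, hi⟩ := mem_iUnion.1 (hc ▸ mem_univ x : _ ∈ ⋃ i, U i)
        exact mem_iUnion.2 ⟨i, hi, Or.inr hx⟩)
  refine ⟨V, hV2, hV1, fun i => (hV3 i).trans inter_subset_left, fun x hx => ?_⟩
  refine le_trans (encard_le_encard fun i hi => ?_) (hW4 ⟨x, hx⟩)
  have := (hV3 i hi).2.resolve_right (fun h => h hx)
  change _ ∈ W i
  rw [← hOW i]
  exact this

/-- The countable closed sum theorem. -/
theorem CoveringDimLE.of_iUnion {X : Type u} [TopologicalSpace X] [NormalSpace X] {F : ℕ → Set X}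
    (hF : ∀ k, IsClosed (F k)) (hFX : ⋃ k, F k = univ) {n : ℕ} (h : ∀ k, CoveringDimLE (F k) n) :
    CoveringDimLE X n := by
  refine .of_forall_exists fun ι _ U hU hc => ?_
  let T := {U : ι → Set X // (∀ i, IsOpen (U i)) ∧ ⋃ i, U i = univ}
  -- The cover is shrunk repeatedly, stage `k` fixing the multiplicity on `F k`. Later shrinkings
  -- preserve what was achieved.
  have hstep : ∀ (k : ℕ) (U : T), ∃ V : T, (∀ i, closure (V.1 i) ⊆ U.1 i) ∧
      ∀ x ∈ F k, {i | x ∈ closure (V.1 i)}.encard ≤ n + 1 := fun k U => by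
    obtain ⟨V, h1, h2, h3, h4⟩ := (h k).exists_shrinking (hF k) U.2.1 U.2.2
    exact ⟨⟨V, h1, h2⟩, h3, h4⟩
  choose next hnext1 hnext2 using hstep
  let V : ℕ → T := fun k => k.rec ⟨U, hU, hc⟩ next
  have hanti : ∀ i, Antitone fun k => (V k).1 i := fun i => antitone_nat_of_succ_le fun k =>
    subset_closure.trans (hnext1 k (V k) i)
  -- The limit sets still cover because there are finitely many indices: a point lost for every `i`
  -- would be lost for all `i` by some common stage. The limit sets are only closed, so they are
  -- swollen to open sets afterwards.
  have hcov : ⋃ i, ⋂ k, closure ((V (k + 1)).1 i) = univ := by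
    refine eq_univ_of_forall fun x => ?_
    by_contra hx
    simp only [mem_iUnion, mem_iInter, not_exists, not_forall] at hx
    choose k hk using hx
    obtain ⟨N, hN⟩ := (finite_range k).bddAbove
    obtain ⟨i, hi⟩ := mem_iUnion.1 ((V (N + 1)).2.2 ▸ mem_univ x : _ ∈ ⋃ i, (V (N + 1)).1 i)
    exact hk i (subset_closure (hanti i (Nat.succ_le_succ (hN (mem_range_self i))) hi))
  obtain ⟨W, hW1, hW2, hW3, hW4⟩ := exists_open_swelling
    (E := fun i => ⋂ k, closure ((V (k + 1)).1 i)) (n := n + 1)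
    (fun i => isClosed_iInter fun k => isClosed_closure) hU
    (fun i => (iInter_subset _ 0).trans (hnext1 0 (V 0) i)) (fun x => by
      obtain ⟨k, hk⟩ := mem_iUnion.1 (hFX ▸ mem_univ x : _ ∈ ⋃ k, F k)
      refine le_trans (encard_le_encard fun i hi => ?_)
        ((hnext2 k (V k) x hk).trans (by push_cast; rfl))
      exact mem_iInter.1 hi k)
  exact ⟨ι, inferInstance, W, hW1, univ_subset_iff.1 (hcov ▸ iUnion_mono hW2),
    fun i => ⟨i, hW3 i⟩, by exact_mod_cast hW4⟩

end CoveringDimension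

/-! ### Disjoint refinements and the product theorem -/

section CoveringDimension

open Set

/-- `G` is a union of pairwise disjoint open sets `D i ⊆ U i`. -/
def IsDisjointlyRefining {X ι : Type*} [TopologicalSpace X] (U : ι → Set X) (G : Set X) : Prop :=
  ∃ D : ι → Set X, (∀ i, IsOpen (D i)) ∧ Pairwise (Function.onFun Disjoint D) ∧
    (∀ i, D i ⊆ U i) ∧ ⋃ i, D i = G

namespace IsDisjointlyRefining

variable {X ι : Type*} [TopologicalSpace X] {U : ι → Set X}

theorem isOpen {G : Set X} (h : IsDisjointlyRefining U G) : IsOpen G := by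
  obtain ⟨D, hD, -, -, rfl⟩ := h
  exact isOpen_iUnion hD

theorem mono {G G' : Set X} (h : IsDisjointlyRefining U G) (hG' : IsOpen G') (hGG' : G' ⊆ G) :
    IsDisjointlyRefining U G' := by
  obtain ⟨D, h1, h2, h3, rfl⟩ := h
  refine ⟨fun i => D i ∩ G', fun i => (h1 i).inter hG',
    fun i j hij => (h2 hij).mono inter_subset_left inter_subset_left,
    fun i => inter_subset_left.trans (h3 i), ?_⟩
  rw [← iUnion_inter, inter_eq_right.2 hGG']

theorem of_subset {G : Set X} {i : ι} (hG : IsOpen G) (h : G ⊆ U i) :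
    IsDisjointlyRefining U G := by
  classical
  refine ⟨fun j => if j = i then G else ∅, fun j => by beta_reduce; split_ifs <;> simp [hG],
    fun j k hjk => ?_,
    fun j => ?_, ?_⟩
  · by_cases hj : j = i
    · have hk : k ≠ i := fun h => hjk (hj.trans h.symm)
      simp [Function.onFun, hk]
    · simp [Function.onFun, hj]
  · by_cases hj : j = i
    · simpa [hj] using h
    · simp [hj]
  · ext x; simp

theorem iUnion {κ : Type*} {G : κ → Set X} (h : ∀ k, IsDisjointlyRefining U (G k))
    (hd : Pairwise (Function.onFun Disjoint G)) : IsDisjointlyRefining U (⋃ k, G k) := by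
  choose D h1 h2 h3 h4 using h
  refine ⟨fun i => ⋃ k, D k i, fun i => isOpen_iUnion fun k => h1 k i, fun i j hij => ?_,
    fun i => iUnion_subset fun k => h3 k i, ?_⟩
  · simp only [Function.onFun, disjoint_iUnion_left, disjoint_iUnion_right]
    intro k l
    by_cases hkl : l = k
    · subst hkl; exact h2 l hij
    · exact (hd hkl).mono (h4 l ▸ subset_iUnion _ _) (h4 k ▸ subset_iUnion _ _)
  · rw [iUnion_comm]
    exact iUnion_congr h4

end IsDisjointlyRefining

/-- Ostrand's colouring. For a partition of unity `f`, let `O s` be the points where the `f i` with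
`i ∈ s` are positive and exceed all the others. If `s ≠ t` have the same size, then `O s` and `O t`
are disjoint, so the sets of size `c + 1` form colour `c`. A point lies in `O s` for `s` the set of
indices with `f i` positive there, which has between `1` and `n + 1` elements. -/
theorem exists_disjointlyRefining_cover {X ι : Type*} [TopologicalSpace X] [NormalSpace X]
    [Finite ι] {n : ℕ} (h : CoveringDimLE X n) {U : ι → Set X} (hU : ∀ i, IsOpen (U i))
    (hc : ⋃ i, U i = univ) :
    ∃ G : Fin (n + 1) → Set X, (∀ c, IsDisjointlyRefining U (G c)) ∧ ⋃ c, G c = univ := by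
  obtain ⟨V, hVo, hVc, hVU, hVn⟩ := h.exists_refinement hU hc
  obtain ⟨f, hf⟩ := PartitionOfUnity.exists_isSubordinate_of_locallyFinite isClosed_univ V hVo
    (locallyFinite_of_finite V) hVc.ge
  have hfV : ∀ i x, 0 < f i x → x ∈ V i := fun i x hx =>
    hf i (subset_tsupport _ (Function.mem_support.2 hx.ne'))
  let O : Set ι → Set X := fun s => {x | ∀ i ∈ s, 0 < f i x ∧ ∀ j ∉ s, f j x < f i x}
  have hO : ∀ s, IsOpen (O s) := fun s => by
    simp only [O, ofPred_forall, ofPred_and]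
    refine isOpen_iInter_of_finite fun i => isOpen_iInter_of_finite fun _ =>
      (isOpen_lt continuous_const (f i).continuous).inter ?_
    exact isOpen_iInter_of_finite fun j => isOpen_iInter_of_finite fun _ =>
      isOpen_lt (f j).continuous (f i).continuous
  refine ⟨fun c => ⋃ s : {s : Set ι // s.encard = (c : ℕ) + 1}, O s.1, fun c => ?_, ?_⟩
  · refine .iUnion (fun s => ?_) fun s t hst => ?_
    · have : s.1.Nonempty := by
        rw [← encard_ne_zero, s.2]; simp
      obtain ⟨i, hi⟩ := this
      exact .of_subset (hO _) (fun x hx => hVU i (hfV i x (hx i hi).1))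
    · have hfin : ∀ t : Set ι, t.Finite := fun t => toFinite t
      have h1 : ¬ s.1 ⊆ t.1 := fun hsub => hst (Subtype.ext
        ((hfin _).eq_of_subset_of_encard_le hsub (by rw [s.2, t.2])))
      have h2 : ¬ t.1 ⊆ s.1 := fun hsub => hst (Subtype.ext
        ((hfin _).eq_of_subset_of_encard_le hsub (by rw [s.2, t.2])).symm)
      obtain ⟨i, his, hit⟩ := not_subset.1 h1
      obtain ⟨j, hjt, hjs⟩ := not_subset.1 h2
      refine disjoint_left.2 fun x hxs hxt => ?_
      exact lt_asymm ((hxs i his).2 j hjs) ((hxt j hjt).2 i hit)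
  · refine eq_univ_of_forall fun x => ?_
    let s : Set ι := {i | 0 < f i x}
    have hs1 : s.encard ≤ n + 1 := (encard_le_encard fun i hi => hfV i x hi).trans (hVn x)
    obtain ⟨i, hi⟩ := f.exists_pos (mem_univ x)
    have hs0 : s.encard ≠ 0 := encard_ne_zero.2 ⟨i, hi⟩
    obtain ⟨m, hm⟩ : ∃ m : ℕ, s.encard = m := ⟨s.ncard, (toFinite s).cast_ncard_eq.symm⟩
    rw [hm] at hs1 hs0
    have hm1 : m ≤ n + 1 := by exact_mod_cast hs1
    have hm0 : m ≠ 0 := by exact_mod_cast hs0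
    refine mem_iUnion.2 ⟨⟨m - 1, by omega⟩, mem_iUnion.2 ⟨⟨s, ?_⟩,
      fun i hi => ⟨hi, fun j hj => ?_⟩⟩⟩
    · rw [hm]; norm_cast; simp; omega
    · exact lt_of_le_of_lt (not_lt.1 hj) hi

/-- If at most `n` of the open sets `G c` miss each point of a normal space, they can be shrunk
so that the same holds. -/
theorem exists_shrinking_of_ncard_le {X κ : Type*} [TopologicalSpace X] [NormalSpace X] [Finite κ]
    {G : κ → Set X} (hG : ∀ c, IsOpen (G c)) {n : ℕ} (hn : ∀ x, {c | x ∉ G c}.ncard ≤ n) :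
    ∃ W : κ → Set X, (∀ c, IsOpen (W c)) ∧ (∀ c, closure (W c) ⊆ G c) ∧
      ∀ x, {c | x ∉ W c}.ncard ≤ n := by
  -- The complements of the `G c` are closed sets of multiplicity at most `n`. They are swollen, and
  -- `W c` is placed between the complement of the swelling and `G c`.
  obtain ⟨V, h1, h2, h3, h4⟩ := exists_open_swelling (E := fun c => (G c)ᶜ) (U := fun _ => univ)
    (fun c => (hG c).isClosed_compl) (fun _ => isOpen_univ) (fun _ => subset_univ _) (n := n)
    (fun x => by
      rw [← (toFinite {i | x ∈ (G i)ᶜ}).cast_ncard_eq]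
      exact_mod_cast hn x)
  choose W hW1 hW2 hW3 using fun c => normal_exists_closure_subset (h1 c).isClosed_compl (hG c)
    (compl_subset_comm.1 (h2 c))
  refine ⟨W, hW1, hW3, fun x => ?_⟩
  have := h4 x
  rw [← (toFinite {i | x ∈ V i}).cast_ncard_eq] at this
  refine le_trans (ncard_le_ncard (fun c hc => ?_) (toFinite _)) (by exact_mod_cast this)
  by_contra hx
  exact hc (hW2 c hx)

/-- A point missed by fewer than `n` of the sets can afford one more miss, so the additional set
only has to catch the points missed by exactly `n`. Those lie in `O s`, where `s` is the set of
colours missing them. The sets `O s` with `s` of size `n` are disjoint, and each lies in some `G c`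
because `n` is less than the number of colours. -/
theorem exists_disjointlyRefining_succ {X ι κ : Type*} [TopologicalSpace X] [NormalSpace X]
    [Finite κ] {U : ι → Set X} {G : κ → Set X} (hG : ∀ c, IsDisjointlyRefining U (G c)) {n : ℕ}
    (hn : ∀ x, {c | x ∉ G c}.ncard ≤ n) (hκ : n < Nat.card κ) :
    ∃ G' : Option κ → Set X, (∀ c, IsDisjointlyRefining U (G' c)) ∧
      ∀ x, {c | x ∉ G' c}.ncard ≤ n := by
  obtain ⟨W, hW1, hW2, hW3⟩ := exists_shrinking_of_ncard_le (fun c => (hG c).isOpen) hn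
  -- `O s` consists of the points that are missed exactly by the sets with index in `s`
  let O : Set κ → Set X := fun s => (⋂ c ∈ sᶜ, W c) ∩ ⋂ c ∈ s, (closure (W c))ᶜ
  have hO : ∀ s, IsOpen (O s) := fun s =>
    (isOpen_iInter_of_finite fun c => isOpen_iInter_of_finite fun _ => hW1 c).inter
      (isOpen_iInter_of_finite fun c => isOpen_iInter_of_finite fun _ =>
        isClosed_closure.isOpen_compl)
  refine ⟨fun c => c.elim (⋃ s : {s : Set κ // s.ncard = n}, O s.1) G, ?_, fun x => ?_⟩
  · rintro (_ | c)
    · refine .iUnion (fun s => ?_) fun s t hst => ?_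
      · have : ∃ c, c ∉ s.1 := by
          by_contra! hall
          have := s.2
          rw [eq_univ_of_forall hall, ncard_univ] at this
          omega
        obtain ⟨c, hc⟩ := this
        exact (hG c).mono (hO _) fun x hx => hW2 c (subset_closure (mem_iInter₂.1 hx.1 c hc))
      · have h1 : ¬ s.1 ⊆ t.1 := fun hsub => hst (Subtype.ext
          (eq_of_subset_of_ncard_le hsub (by rw [s.2, t.2])))
        obtain ⟨c, hcs, hct⟩ := not_subset.1 h1
        refine disjoint_left.2 fun x hxs hxt => ?_
        exact mem_iInter₂.1 hxs.2 c hcs (subset_closure (mem_iInter₂.1 hxt.1 c hct))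
    · exact hG c
  · let s := {c | x ∉ G c}
    have hsub : s ⊆ {c | x ∉ W c} := fun c hc hx => hc (hW2 c (subset_closure hx))
    rcases (hn x).lt_or_eq with hlt | heq
    · have : {c : Option κ | x ∉ c.elim (⋃ s : {s : Set κ // s.ncard = n}, O s.1) G} ⊆
          insert none (some '' s) := by
        rintro (_ | c) hc
        · exact mem_insert _ _
        · exact mem_insert_of_mem _ ⟨c, hc, rfl⟩
      refine (ncard_le_ncard this (toFinite _)).trans ((ncard_insert_le _ _).trans ?_)
      rw [ncard_image_of_injective _ (Option.some_injective κ)]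
      exact hlt
    · have hWs : {c | x ∉ W c} = s := (eq_of_subset_of_ncard_le hsub (by
        rw [show s.ncard = n from heq]; exact hW3 x)).symm
      have : {c : Option κ | x ∉ c.elim (⋃ s : {s : Set κ // s.ncard = n}, O s.1) G} ⊆
          some '' s := by
        rintro (_ | c) hc
        · have hx : x ∈ O s := ⟨mem_iInter₂.2 fun c hc => by
              by_contra hx
              exact hc (hWs ▸ hx), mem_iInter₂.2 fun c hc hx => hc (hW2 c hx)⟩
          exact absurd (mem_iUnion.2 ⟨⟨s, heq⟩, hx⟩) hc
        · exact ⟨c, hc, rfl⟩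
      refine (ncard_le_ncard this (toFinite _)).trans ?_
      rw [ncard_image_of_injective _ (Option.some_injective κ)]
      exact heq.le

/-- In a normal space of dimension at most `n` there are, for each finite open cover and each
`N > n`, disjoint refinements `G 0, …, G (N - 1)` of the cover such that each point is missed by
at most `n` of them. -/
theorem CoveringDimLE.exists_disjointlyRefining {X ι : Type*} [TopologicalSpace X] [NormalSpace X]
    [Finite ι] {n : ℕ} (h : CoveringDimLE X n) {U : ι → Set X} (hU : ∀ i, IsOpen (U i))
    (hc : ⋃ i, U i = univ) (N : ℕ) (hN : n + 1 ≤ N) :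
    ∃ G : Fin N → Set X, (∀ c, IsDisjointlyRefining U (G c)) ∧
      ∀ x, {c | x ∉ G c}.ncard ≤ n := by
  induction N, hN using Nat.le_induction with
  | base =>
    obtain ⟨G, hG, hGc⟩ := exists_disjointlyRefining_cover h hU hc
    refine ⟨G, hG, fun x => ?_⟩
    obtain ⟨c, hc⟩ := mem_iUnion.1 (hGc ▸ mem_univ x : x ∈ ⋃ c, G c)
    have hlt : {c | x ∉ G c} ⊂ univ := ⟨subset_univ _, fun hsub => hsub (mem_univ c) hc⟩
    have := ncard_lt_ncard hlt (toFinite _)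
    rw [ncard_univ, Nat.card_fin] at this
    exact Nat.le_of_lt_succ this
  | succ N hN ih =>
    obtain ⟨G, hG, hGn⟩ := ih
    obtain ⟨G', hG', hGnext⟩ := exists_disjointlyRefining_succ hG hGn (by rw [Nat.card_fin]; omega)
    let e : Fin (N + 1) ≃ Option (Fin N) := finSuccEquiv N
    refine ⟨fun c => G' (e c), fun c => hG' _, fun x => ?_⟩
    have : {c | x ∉ G' (e c)} = e.symm '' {c | x ∉ G' c} := by
      rw [e.symm.image_eq_preimage_symm]; rfl
    rw [this, ncard_image_of_injective _ e.symm.injective]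
    exact hGnext x

/-- Open covers of a product of two compact spaces are refined by products of finite open
covers. -/
theorem exists_prod_refinement {X Y ι : Type*} [TopologicalSpace X] [TopologicalSpace Y]
    [CompactSpace X] [CompactSpace Y] [T2Space X] [T2Space Y] {O : ι → Set (X × Y)}
    (hO : ∀ i, IsOpen (O i)) (hc : ⋃ i, O i = univ) :
    ∃ (s : Finset X) (t : Finset Y) (U : X → Set X) (V : Y → Set Y),
      (∀ x, IsOpen (U x)) ∧ (∀ y, IsOpen (V y)) ∧ ⋃ x : s, U x = univ ∧ ⋃ y : t, V y = univ ∧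
      ∀ x y, ∃ i, U x ×ˢ V y ⊆ O i := by
  -- Compact Hausdorff spaces are uniform, so the Lebesgue number lemma applies. An entourage of the
  -- product contains a product of entourages, and balls of these two give the covers of the
  -- factors.
  let _ : UniformSpace X := uniformSpaceOfCompactR1
  let _ : UniformSpace Y := uniformSpaceOfCompactR1
  obtain ⟨W, hW, hWO⟩ := lebesgue_number_lemma isCompact_univ hO hc.ge
  obtain ⟨A, hA, B, hB, hAB⟩ := entourageProd_subset hW
  obtain ⟨s, -, hs⟩ := isCompact_univ.elim_nhds_subcover
    (fun x : X => interior (UniformSpace.ball x A))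
    fun x _ => interior_mem_nhds.2 (UniformSpace.ball_mem_nhds x hA)
  obtain ⟨t, -, ht⟩ := isCompact_univ.elim_nhds_subcover
    (fun y : Y => interior (UniformSpace.ball y B))
    fun y _ => interior_mem_nhds.2 (UniformSpace.ball_mem_nhds y hB)
  refine ⟨s, t, fun x => interior (UniformSpace.ball x A),
    fun y => interior (UniformSpace.ball y B),
    fun _ => isOpen_interior, fun _ => isOpen_interior, univ_subset_iff.1 (hs.trans ?_),
    univ_subset_iff.1 (ht.trans ?_), fun x y => ?_⟩
  · exact iUnion₂_subset fun x hx =>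
      subset_iUnion (fun x : s => interior (UniformSpace.ball x.1 A)) ⟨x, hx⟩
  · exact iUnion₂_subset fun x hx =>
      subset_iUnion (fun x : t => interior (UniformSpace.ball x.1 B)) ⟨x, hx⟩
  · obtain ⟨i, hi⟩ := hWO (x, y) (mem_univ _)
    refine ⟨i, fun p hp => hi (hAB ?_)⟩
    have h1 : p.1 ∈ UniformSpace.ball x A := interior_subset hp.1
    have h2 : p.2 ∈ UniformSpace.ball y B := interior_subset hp.2
    exact ⟨h1, h2⟩

/-- The product theorem for compact Hausdorff spaces. -/
theorem CoveringDimLE.prod {X : Type u} {Y : Type v} [TopologicalSpace X] [TopologicalSpace Y]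
    [CompactSpace X] [CompactSpace Y] [T2Space X] [T2Space Y] {n m : ℕ} (hX : CoveringDimLE X n)
    (hY : CoveringDimLE Y m) : CoveringDimLE (X × Y) (n + m) := by
  refine .of_forall_exists fun ι _ O hO hc => ?_
  obtain ⟨s, t, U, V, hU, hV, hUc, hVc, hUV⟩ := exists_prod_refinement hO hc
  obtain ⟨G, hG, hGn⟩ := hX.exists_disjointlyRefining (U := fun x : s => U x) (fun x => hU x) hUc
    (n + m + 1) (by omega)
  obtain ⟨G', hG', hGn'⟩ := hY.exists_disjointlyRefining (U := fun y : t => V y) (fun y => hV y) hVc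
    (n + m + 1) (by omega)
  choose D hD1 hD2 hD3 hD4 using hG
  choose D' hD1' hD2' hD3' hD4' using hG'
  refine ⟨ULift.{max u v} (Fin (n + m + 1)) × s × t, inferInstance,
    fun p => D p.1.down p.2.1 ×ˢ D' p.1.down p.2.2, fun p => (hD1 _ _).prod (hD1' _ _), ?_,
    fun p => ?_, fun z => ?_⟩
  · refine eq_univ_of_forall fun z => ?_
    -- With `n + m + 1` colours, at most `n` miss the first coordinate and at most `m` the second,
    -- so at least one colour contains both.
    obtain ⟨c, hc1, hc2⟩ : ∃ c, z.1 ∈ G c ∧ z.2 ∈ G' c := by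
      by_contra! hno
      have hsub : (univ : Set (Fin (n + m + 1))) ⊆ {c | z.1 ∉ G c} ∪ {c | z.2 ∉ G' c} :=
        fun c _ => by
          by_cases hz : z.1 ∈ G c
          · exact Or.inr (hno c hz)
          · exact Or.inl hz
      have h1 := (ncard_le_ncard hsub (toFinite _)).trans (ncard_union_le _ _)
      rw [ncard_univ, Nat.card_fin] at h1
      have h2 := hGn z.1
      have h3 := hGn' z.2
      omega
    rw [← hD4 c] at hc1
    rw [← hD4' c] at hc2
    obtain ⟨a, ha⟩ := mem_iUnion.1 hc1
    obtain ⟨b, hb⟩ := mem_iUnion.1 hc2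
    exact mem_iUnion.2 ⟨(⟨c⟩, a, b), ha, hb⟩
  · obtain ⟨i, hi⟩ := hUV p.2.1 p.2.2
    exact ⟨i, (prod_mono (hD3 _ _) (hD3' _ _)).trans hi⟩
  -- Products of one colour are pairwise disjoint, so the multiplicity is at most the number of
  -- colours, `n + m + 1`.
  · have hinj : InjOn (fun p : ULift.{max u v} (Fin (n + m + 1)) × s × t => p.1)
        {p | z ∈ D p.1.down p.2.1 ×ˢ D' p.1.down p.2.2} := by
      rintro ⟨c, a, b⟩ ⟨h1, h2⟩ ⟨c', a', b'⟩ ⟨h1', h2'⟩ (rfl : c = c')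
      have ha : a = a' := by
        by_contra hne
        exact disjoint_left.1 (hD2 c.down hne) h1 h1'
      have hb : b = b' := by
        by_contra hne
        exact disjoint_left.1 (hD2' c.down hne) h2 h2'
      rw [ha, hb]
    rw [← hinj.encard_image]
    refine (encard_le_encard (subset_univ _)).trans ?_
    rw [encard_univ, ENat.card_eq_coe_natCard]
    simp

end CoveringDimension

/-! ### Pure states and the existence of irreducible representations -/

section States

open Set

/-- The states of a C⋆-algebra as a set of functions. -/
def stateSet (A : Type*) [CStarAlgebra A] : Set (A → ℂ) :=
  {f | IsLinearMap ℂ f ∧ (∀ a, 0 ≤ f (star a * a)) ∧ f 1 = 1}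

variable {A : Type u} [CStarAlgebra A]

/-- The positive linear functional of a state. -/
def stateSet.toCStarState {f : A → ℂ} (hf : f ∈ stateSet A) : CStarState A :=
  letI := CStarAlgebra.spectralOrder A
  haveI := CStarAlgebra.spectralOrderedRing A
  ⟨PositiveLinearMap.mk₀ (hf.1.mk' f) fun x hx => by
    obtain ⟨b, rfl⟩ := CStarAlgebra.nonneg_iff_eq_star_mul_self.1 hx
    exact hf.2.1 b, hf.2.2⟩

namespace CStarState

/-- The canonical cyclic vector of the GNS space. -/
def vec (φ : CStarState A) : φ.Space :=
  letI := CStarAlgebra.spectralOrder A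
  haveI := CStarAlgebra.spectralOrderedRing A
  ((φ.1.toPreGNS 1 : φ.1.PreGNS) : φ.1.GNS)

/-- The value of a state. -/
def val (φ : CStarState A) (a : A) : ℂ :=
  letI := CStarAlgebra.spectralOrder A
  φ.1 a

theorem rep_vec_eq (φ : CStarState A) (a : A) :
    letI := CStarAlgebra.spectralOrder A
    haveI := CStarAlgebra.spectralOrderedRing A
    φ.rep a φ.vec = ((φ.1.toPreGNS a : φ.1.PreGNS) : φ.1.GNS) := by
  let _ := CStarAlgebra.spectralOrder A
  have := CStarAlgebra.spectralOrderedRing A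
  refine (PositiveLinearMap.gnsNonUnitalStarAlgHom_apply_coe φ.1).trans ?_
  simp

theorem denseRange_rep_vec (φ : CStarState A) : DenseRange fun a => φ.rep a φ.vec := by
  let _ := CStarAlgebra.spectralOrder A
  have := CStarAlgebra.spectralOrderedRing A
  have h : (fun a => φ.rep a φ.vec) = fun a => ((φ.1.toPreGNS a : φ.1.PreGNS) : φ.1.GNS) :=
    funext fun a => φ.rep_vec_eq a
  rw [h]
  exact UniformSpace.Completion.denseRange_coe.comp φ.1.toPreGNS.surjective.denseRange
    (UniformSpace.Completion.continuous_coe _)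

theorem inner_rep_vec (φ : CStarState A) (a b : A) :
    inner ℂ (φ.rep a φ.vec) (φ.rep b φ.vec) = φ.val (star a * b) := by
  let _ := CStarAlgebra.spectralOrder A
  have := CStarAlgebra.spectralOrderedRing A
  rw [rep_vec_eq, rep_vec_eq]
  refine (UniformSpace.Completion.inner_coe _ _).trans ?_
  rfl

theorem inner_vec_rep (φ : CStarState A) (a : A) : inner ℂ φ.vec (φ.rep a φ.vec) = φ.val a := by
  simpa using φ.inner_rep_vec 1 a

theorem norm_vec (φ : CStarState A) : ‖φ.vec‖ = 1 := by
  have h : ((‖φ.vec‖ : ℂ)) ^ 2 = 1 := by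
    have h1 := φ.inner_vec_rep 1
    rw [map_one, one_apply_eq_self, inner_self_eq_norm_sq_to_K] at h1
    exact h1.trans φ.2
  rw [← pow_eq_one_iff_of_nonneg (norm_nonneg _) two_ne_zero]
  exact_mod_cast h

end CStarState

theorem IsLinearMap.norm_le_of_mem_stateSet {f : A → ℂ} (hf : f ∈ stateSet A) (a : A) :
    ‖f a‖ ≤ ‖a‖ := by
  let φ := stateSet.toCStarState hf
  have h1 : inner ℂ φ.vec (φ.rep a φ.vec) = f a := φ.inner_vec_rep a
  rw [← h1]
  calc _ ≤ ‖φ.vec‖ * ‖φ.rep a φ.vec‖ := norm_inner_le_norm _ _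
    _ ≤ ‖φ.vec‖ * (‖φ.rep a‖ * ‖φ.vec‖) := by gcongr; exact ContinuousLinearMap.le_opNorm _ _
    _ ≤ ‖a‖ := by
      rw [φ.norm_vec, one_mul, mul_one]
      exact NonUnitalStarAlgHom.norm_apply_le _ a

/-- The states form a set of functions closed under pointwise convergence inside the product of the
discs of radius `‖a‖`, and Tychonoff's theorem applies. -/
theorem isCompact_stateSet : IsCompact (stateSet A) := by
  have h1 : IsCompact (Set.pi univ fun a : A => Metric.closedBall (0 : ℂ) ‖a‖) :=
    isCompact_univ_pi fun a => isCompact_closedBall _ _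
  refine h1.of_isClosed_subset ?_ fun f hf a _ => by
    simpa using IsLinearMap.norm_le_of_mem_stateSet hf a
  have : stateSet A = (⋂ (a : A) (b : A), {f | f (a + b) = f a + f b}) ∩
      (⋂ (c : ℂ) (a : A), {f | f (c • a) = c • f a}) ∩ (⋂ a : A, {f | 0 ≤ f (star a * a)}) ∩
      {f | f 1 = 1} := by
    ext f
    simp only [stateSet, mem_inter_iff, mem_iInter, mem_ofPred_eq]
    constructor
    · rintro ⟨h1, h2, h3⟩
      exact ⟨⟨⟨h1.map_add, h1.map_smul⟩, h2⟩, h3⟩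
    · rintro ⟨⟨⟨h1, h2⟩, h3⟩, h4⟩
      exact ⟨⟨h1, h2⟩, h3, h4⟩
  rw [this]
  refine (((isClosed_iInter fun a => isClosed_iInter fun b => ?_).inter
    (isClosed_iInter fun c => isClosed_iInter fun a => ?_)).inter
    (isClosed_iInter fun a => ?_)).inter ?_
  · exact isClosed_eq (by fun_prop) (by fun_prop)
  · exact isClosed_eq (by fun_prop) (by fun_prop)
  · exact isClosed_le continuous_const (continuous_apply _)
  · exact isClosed_eq (continuous_apply _) continuous_const

/-- Hahn–Banach separation of `-(star x * x)` from the cone of positive elements yields a real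
functional that is positive on the cone and strictly positive at `star x * x`. It is made complex
linear and normalised. -/
theorem exists_state_pos {x : A} (hx : x ≠ 0) : ∃ f ∈ stateSet A, 0 < (f (star x * x)).re := by
  let _ := CStarAlgebra.spectralOrder A
  have := CStarAlgebra.spectralOrderedRing A
  set b := star x * x with hb
  have hb0 : 0 ≤ b := star_mul_self_nonneg x
  have hb1 : b ≠ 0 := fun h => hx (CStarRing.star_mul_self_eq_zero_iff x |>.1 h)
  obtain ⟨f, hf, hfb⟩ := (ProperCone.positive ℝ A).hyperplane_separation_point (x₀ := -b) (by
    intro h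
    have h' : 0 ≤ -b := h
    exact hb1 (le_antisymm (neg_nonneg.1 h') hb0))
  replace hf : ∀ a : A, 0 ≤ a → 0 ≤ f a := hf
  rw [map_neg, neg_lt_zero] at hfb
  -- Symmetrising makes `g` vanish at `I • a` for self-adjoint `a`, so its complexification takes
  -- the real value `f a` at positive `a`.
  let g : Module.Dual ℝ A :=
    { toFun := fun a => f ((2⁻¹ : ℝ) • (a + star a))
      map_add' := fun a c => by rw [← map_add, ← smul_add]; congr 2; rw [star_add]; abel
      map_smul' := fun r a => by
        rw [RingHom.id_apply, ← map_smul, star_smul, star_trivial, ← smul_add, smul_comm] }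
  have hg : ∀ a : A, 0 ≤ a → (Module.Dual.extendRCLike (𝕜 := ℂ) g) a = (f a : ℂ) := by
    intro a ha
    have hsa : star a = a := (IsSelfAdjoint.of_nonneg ha).star_eq
    have h1 : g a = f a := by
      change f ((2⁻¹ : ℝ) • (a + star a)) = f a
      rw [hsa, ← two_smul ℝ a, smul_smul]; norm_num
    have h2 : g (Complex.I • a) = 0 := by
      change f ((2⁻¹ : ℝ) • (Complex.I • a + star (Complex.I • a))) = 0
      simp [star_smul, hsa]
    rw [Module.Dual.extendRCLike_apply]
    erw [h2]
    rw [h1]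
    simp
  have hle : b ≤ ‖b‖ • (1 : A) := by
    rw [← Algebra.algebraMap_eq_smul_one]
    exact IsSelfAdjoint.le_algebraMap_norm_self (.of_nonneg hb0)
  have hf1 : 0 < f 1 := by
    have h1 := hf _ (sub_nonneg.2 hle)
    rw [map_sub, map_smul, smul_eq_mul] at h1
    by_contra! hneg
    have := mul_nonpos_of_nonneg_of_nonpos (norm_nonneg b) hneg
    linarith
  refine ⟨fun a => (f 1 : ℂ)⁻¹ * (Module.Dual.extendRCLike (𝕜 := ℂ) g) a, ⟨⟨fun a c => ?_,
    fun r a => ?_⟩, fun a => ?_, ?_⟩, ?_⟩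
  · rw [map_add, mul_add]
  · rw [map_smul, smul_eq_mul, smul_eq_mul]; ring
  · beta_reduce
    rw [hg _ (star_mul_self_nonneg a)]
    have := hf _ (star_mul_self_nonneg a)
    rw [← Complex.ofReal_inv, ← Complex.ofReal_mul]
    exact Complex.zero_le_real.2 (by positivity)
  · beta_reduce
    rw [hg 1 zero_le_one]
    exact inv_mul_cancel₀ (by exact_mod_cast hf1.ne')
  · beta_reduce
    rw [hg b hb0, ← Complex.ofReal_inv, ← Complex.ofReal_mul, Complex.ofReal_re]
    positivity

/-- The states maximising the value at `star x * x` form a nonempty compact exposed face. By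
Krein–Milman it has an extreme point, and this is extreme among all states. -/
theorem exists_extreme_state_pos {x : A} (hx : x ≠ 0) :
    ∃ f ∈ (stateSet A).extremePoints ℝ, 0 < (f (star x * x)).re := by
  obtain ⟨g, hg, hgx⟩ := exists_state_pos hx
  let l : (A → ℂ) →L[ℝ] ℝ := Complex.reCLM.comp (ContinuousLinearMap.proj (star x * x))
  have h : IsExposed ℝ (stateSet A) {f ∈ stateSet A | ∀ f' ∈ stateSet A, l f' ≤ l f} :=
    fun _ => ⟨l, rfl⟩
  obtain ⟨z, hz, hzmax⟩ := isCompact_stateSet.exists_isMaxOn ⟨g, hg⟩ l.continuous.continuousOn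
  obtain ⟨f, hf⟩ := (h.isCompact isCompact_stateSet).extremePoints_nonempty ⟨z, hz, hzmax⟩
  exact ⟨f, h.isExtreme.extremePoints_subset_extremePoints hf, hgx.trans_le (hf.1.2 g hg)⟩

variable {H : Type*} [NormedAddCommGroup H] [InnerProductSpace ℂ H] [CompleteSpace H]

theorem StarAlgHom.inner_apply_left (π : A →⋆ₐ[ℂ] (H →L[ℂ] H)) (a : A) (x y : H) :
    inner ℂ (π a x) y = inner ℂ x (π (star a) y) := by
  rw [map_star, ContinuousLinearMap.star_eq_adjoint, ContinuousLinearMap.adjoint_inner_right]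

theorem StarAlgHom.apply_mem_orthogonal (π : A →⋆ₐ[ℂ] (H →L[ℂ] H)) {M : Submodule ℂ H}
    (hM : ∀ a, ∀ x ∈ M, π a x ∈ M) (a : A) {x : H} (hx : x ∈ Mᗮ) : π a x ∈ Mᗮ := by
  rw [Submodule.mem_orthogonal] at hx ⊢
  intro y hy
  rw [← star_star a, ← StarAlgHom.inner_apply_left]
  exact hx _ (hM _ _ hy)

theorem vectorState_mem_stateSet (π : A →⋆ₐ[ℂ] (H →L[ℂ] H)) {ξ : H} (hξ : ‖ξ‖ = 1) :
    (fun a => inner ℂ ξ (π a ξ)) ∈ stateSet A := by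
  refine ⟨⟨fun a b => by simp, fun c a => by simp⟩,
    fun a => ?_, by simp [inner_self_eq_norm_sq_to_K, hξ]⟩
  have h : inner ℂ ξ (π (star a * a) ξ) = inner ℂ (π a ξ) (π a ξ) := by
    rw [StarAlgHom.inner_apply_left, map_mul]; rfl
  beta_reduce
  rw [h, inner_self_eq_norm_sq_to_K]
  norm_cast
  exact Complex.zero_le_real.2 (sq_nonneg _)

theorem eq_top_of_denseRange (π : A →⋆ₐ[ℂ] (H →L[ℂ] H)) {ξ : H}
    (hd : DenseRange fun a => π a ξ) {M : Submodule ℂ H} (hcl : IsClosed (M : Set H))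
    (hM : ∀ a, ∀ x ∈ M, π a x ∈ M) (hξ : ξ ∈ M) : M = ⊤ := by
  refine SetLike.coe_injective ?_
  rw [Submodule.top_coe, eq_univ_iff_forall]
  exact fun y => closure_minimal (by rintro _ ⟨a, rfl⟩; exact hM a _ hξ) hcl (hd y)

/-- Cyclic representations with a pure vector state are irreducible. -/
theorem isIrreducibleRep_of_mem_extremePoints (π : A →⋆ₐ[ℂ] (H →L[ℂ] H)) {ξ : H} (hξ : ‖ξ‖ = 1)
    (hd : DenseRange fun a => π a ξ)
    (hext : (fun a => inner ℂ ξ (π a ξ)) ∈ (stateSet A).extremePoints ℝ) :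
    IsIrreducibleRep π := by
  refine ⟨⟨ξ, 0, fun h => by simp [h] at hξ⟩, fun M hcl hM => ?_⟩
  have := hcl.completeSpace_coe
  obtain ⟨x, hx, y, hy, hxy⟩ := M.exists_add_mem_mem_orthogonal ξ
  by_cases hy0 : y = 0
  · rw [hy0, add_zero] at hxy
    exact Or.inr (eq_top_of_denseRange π hd hcl hM (hxy ▸ hx))
  by_cases hx0 : x = 0
  · rw [hx0, zero_add] at hxy
    left
    rw [← Submodule.orthogonal_eq_top_iff]
    exact eq_top_of_denseRange π hd M.isClosed_orthogonal
      (fun a x hx => StarAlgHom.apply_mem_orthogonal π hM a hx) (hxy ▸ hy)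
  right
  have hxpos : 0 < ‖x‖ := norm_pos_iff.2 hx0
  have hypos : 0 < ‖y‖ := norm_pos_iff.2 hy0
  have hxy0 : ∀ a, inner ℂ x (π a y) = 0 := fun a =>
    Submodule.inner_right_of_mem_orthogonal hx (StarAlgHom.apply_mem_orthogonal π hM a hy)
  have hyx0 : ∀ a, inner ℂ y (π a x) = 0 := fun a =>
    Submodule.inner_left_of_mem_orthogonal (hM a x hx) hy
  have hsum : ‖x‖ ^ 2 + ‖y‖ ^ 2 = 1 := by
    have h1 := norm_add_sq_eq_norm_sq_add_norm_sq_of_inner_eq_zero x y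
      (Submodule.inner_right_of_mem_orthogonal hx hy)
    rw [← hxy, hξ] at h1
    linarith
  have hn : ∀ {z : H} (_ : 0 < ‖z‖) (a : A), ((‖z‖ ^ 2 : ℝ) : ℂ) *
      inner ℂ ((‖z‖⁻¹ : ℂ) • z) (π a ((‖z‖⁻¹ : ℂ) • z)) = inner ℂ z (π a z) := fun {z} hz a => by
    have : (‖z‖ : ℂ) ≠ 0 := by exact_mod_cast hz.ne'
    simp only [map_smul, inner_smul_left, inner_smul_right, map_inv₀, Complex.conj_ofReal,
      Complex.ofReal_pow]
    field_simp
  have hu : ∀ {z : H} (_ : 0 < ‖z‖), ‖(‖z‖⁻¹ : ℂ) • z‖ = 1 := fun {z} hz => by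
    rw [norm_smul]; simp [hz.ne']
  obtain ⟨-, hext⟩ := mem_extremePoints_iff_left.1 hext
  -- The vector state of `ξ = x + y` is the convex combination, with weights `‖x‖ ^ 2` and `‖y‖ ^
  -- 2`, of those of the normalised components. Extremality makes it equal to the first.
  have heq := hext _ (vectorState_mem_stateSet π (hu hxpos)) _
    (vectorState_mem_stateSet π (hu hypos))
    ⟨‖x‖ ^ 2, ‖y‖ ^ 2, by positivity, by positivity, hsum, funext fun a => by
      simp only [Pi.add_apply, Pi.smul_apply, Complex.real_smul]
      rw [hn hxpos, hn hypos]
      rw [hxy, map_add, inner_add_left, inner_add_right, inner_add_right, hxy0, hyx0]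
      ring⟩
  -- The equality of states says that `x - ‖x‖ ^ 2 • ξ` is orthogonal to the dense orbit of `ξ`.
  -- Thus `ξ` is a multiple of `x` and lies in `M`.
  have hz : x - ((‖x‖ ^ 2 : ℝ) : ℂ) • ξ = 0 := by
    have h0 : ∀ z, inner ℂ (x - ((‖x‖ ^ 2 : ℝ) : ℂ) • ξ) z = 0 := by
      refine fun z => hd.induction_on (p := fun z => inner ℂ (x - ((‖x‖ ^ 2 : ℝ) : ℂ) • ξ) z = 0) _
        (isClosed_eq (by fun_prop) continuous_const) fun a => ?_
      have h1 := congrFun heq a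
      have h2 := hn hxpos a
      beta_reduce at h1
      rw [h1] at h2
      rw [inner_sub_left, inner_smul_left, Complex.conj_ofReal, h2]
      conv_lhs => rw [hxy, map_add, inner_add_right, hxy0]
      ring
    exact inner_self_eq_zero.1 (h0 _)
  have hξM : ξ ∈ M := by
    have h1 : ((‖x‖ ^ 2 : ℝ) : ℂ) ≠ 0 := by exact_mod_cast (pow_pos hxpos 2).ne'
    rw [sub_eq_zero] at hz
    rw [← inv_smul_smul₀ h1 ξ, ← hz]
    exact M.smul_mem _ hx
  exact eq_top_of_denseRange π hd hcl hM hξM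

/-- The irreducible representations separate the points of a C⋆-algebra. -/
theorem exists_isIrreducibleRep_apply_ne_zero {x : A} (hx : x ≠ 0) :
    ∃ φ : CStarState A, IsIrreducibleRep φ.rep ∧ φ.rep x ≠ 0 := by
  obtain ⟨f, hf, hfx⟩ := exists_extreme_state_pos hx
  let φ := stateSet.toCStarState hf.1
  have h1 : (fun b => inner ℂ φ.vec (φ.rep b φ.vec)) = f := funext φ.inner_vec_rep
  refine ⟨φ, isIrreducibleRep_of_mem_extremePoints φ.rep φ.norm_vec φ.denseRange_rep_vec
    (h1 ▸ hf), ?_⟩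
  intro h0
  rw [← h1] at hfx
  simp [map_mul, h0] at hfx

end States

/-! ### Finite-dimensional irreducible representations -/

section FiniteDimensional

variable {A : Type*} [CStarAlgebra A]
  {E : Type*} [NormedAddCommGroup E] [InnerProductSpace ℂ E]

/-- Burnside's theorem: irreducible finite-dimensional representations are surjective. -/
theorem IsIrreducibleRep.surjective [CompleteSpace E] [FiniteDimensional ℂ E]
    {π : A →⋆ₐ[ℂ] (E →L[ℂ] E)} (hπ : IsIrreducibleRep π) :
    Function.Surjective π := by
  let _ : Module A E := Module.compHom E (π : A →+* (E →L[ℂ] E))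
  have hsmul : ∀ (a : A) (x : E), a • x = π a x := fun _ _ => rfl
  have := hπ.nontrivial
  have : IsScalarTower ℂ A E := ⟨fun c a x => by simp [hsmul]⟩
  have : IsSimpleModule A E := by
    rw [isSimpleModule_iff]
    refine { exists_pair_ne := ⟨⊥, ⊤, bot_ne_top⟩, eq_bot_or_eq_top := fun M => ?_ }
    rcases hπ.eq_bot_or_eq_top (M.restrictScalars ℂ) (Submodule.closed_of_finiteDimensional _)
      (fun a x hx => M.smul_mem a hx) with h | h
    · exact Or.inl (by simpa using h)
    · exact Or.inr (by simpa using h)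
  intro T
  -- Schur's lemma: an eigenspace of an intertwiner is invariant. So every linear `T` commutes with
  -- all intertwiners, and Jacobson density realises it on a basis.
  have hD : ∀ D : Module.End A E, ∃ μ : ℂ, ∀ x, D x = μ • x := fun D => by
    let D' : Module.End ℂ E := D.restrictScalars ℂ
    obtain ⟨μ, hμ⟩ := Module.End.exists_eigenvalue D'
    obtain ⟨x, hx⟩ := hμ.exists_hasEigenvector
    refine ⟨μ, fun y => ?_⟩
    rcases hπ.eq_bot_or_eq_top (D'.eigenspace μ) (Submodule.closed_of_finiteDimensional _)
      (fun a z hz => by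
        rw [Module.End.mem_eigenspace_iff] at hz ⊢
        change D (a • z) = _
        rw [map_smul, show D z = μ • z from hz, hsmul, map_smul]) with h | h
    · exact absurd (h ▸ hx.1 : x ∈ (⊥ : Submodule ℂ E)) hx.2
    · exact Module.End.mem_eigenspace_iff.1 (h ▸ Submodule.mem_top : y ∈ D'.eigenspace μ)
  let f : Module.End (Module.End A E) E :=
    { toFun := T
      map_add' := map_add T
      map_smul' := fun D x => by
        obtain ⟨μ, hμ⟩ := hD D
        simp [hμ] }
  classical
  let b := Module.finBasis ℂ E
  obtain ⟨r, hr⟩ := jacobson_density f (Finset.univ.image b)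
  refine ⟨r, ContinuousLinearMap.coe_injective (b.ext fun i => ?_)⟩
  exact (hr (b i) (by simp)).symm

theorem isIrreducibleRep_of_surjective [CompleteSpace E] [Nontrivial E] {π : A →⋆ₐ[ℂ] (E →L[ℂ] E)}
    (hπ : Function.Surjective π) : IsIrreducibleRep π := by
  refine ⟨inferInstance, fun M _ hM => ?_⟩
  by_contra! h
  obtain ⟨x, hx, hx0⟩ := M.ne_bot_iff.1 h.1
  refine h.2 (Submodule.eq_top_iff'.2 fun y => ?_)
  obtain ⟨a, ha⟩ := hπ (InnerProductSpace.rankOne ℂ y x)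
  have := hM a ((inner ℂ x x)⁻¹ • x) (M.smul_mem _ hx)
  rwa [ha, InnerProductSpace.rankOne_apply, inner_smul_right, inv_mul_cancel₀ (by simpa using hx0),
    one_smul] at this

instance isSimpleRing_endCLM [FiniteDimensional ℂ E] [Nontrivial E] :
    IsSimpleRing (E →L[ℂ] E) := by
  have : Nonempty (Fin (Module.finrank ℂ E)) := ⟨⟨0, Module.finrank_pos⟩⟩
  exact .of_ringEquiv ((LinearMap.toMatrixAlgEquiv (Module.finBasis ℂ E)).symm.trans
    (Module.End.toContinuousLinearMap E)).toRingEquiv (inferInstanceAs (IsSimpleRing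
      (Matrix (Fin (Module.finrank ℂ E)) (Fin (Module.finrank ℂ E)) ℂ)))

theorem finrank_endCLM [FiniteDimensional ℂ E] :
    Module.finrank ℂ (E →L[ℂ] E) = Module.finrank ℂ E ^ 2 := by
  rw [← (LinearMap.toContinuousLinearMap (𝕜 := ℂ) (E := E) (F' := E)).finrank_eq,
    Module.finrank_linearMap, sq]

/-- A homomorphism that vanishes on the kernel of an irreducible finite-dimensional representation
factors through it. -/
theorem exists_factor [CompleteSpace E] [FiniteDimensional ℂ E] [Nontrivial E]
    {ρ : A →⋆ₐ[ℂ] (E →L[ℂ] E)} (hρ : Function.Surjective ρ)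
    {D : Type*} [Ring D] [Algebra ℂ D] [Nontrivial D] (σ : A →ₐ[ℂ] D)
    (h : ∀ a, ρ a = 0 → σ a = 0) :
    ∃ θ : (E →L[ℂ] E) →ₐ[ℂ] D, Function.Injective θ ∧ ∀ a, σ a = θ (ρ a) := by
  let r : A →ₐ[ℂ] (E →L[ℂ] E) := ρ
  let θ : (E →L[ℂ] E) →ₐ[ℂ] D := (Ideal.Quotient.liftₐ (RingHom.ker r) σ h).comp
    (Ideal.quotientKerAlgEquivOfSurjective (f := r) hρ).symm.toAlgHom
  -- The factored map is injective because the operators on `E` form a simple ring.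
  refine ⟨θ, (θ : (E →L[ℂ] E) →+* D).injective, fun a => ?_⟩
  have h1 : (Ideal.quotientKerAlgEquivOfSurjective (f := r) hρ).symm (r a) =
      Ideal.Quotient.mk _ a := by
    rw [AlgEquiv.symm_apply_eq]; rfl
  change σ a = Ideal.Quotient.liftₐ (RingHom.ker r) σ h
    ((Ideal.quotientKerAlgEquivOfSurjective (f := r) hρ).symm (r a))
  rw [h1]
  rfl

end FiniteDimensional

/-! ### Compactness of the space of representations on a fixed finite-dimensional space -/

section Compactness

variable {A : Type u} [CStarAlgebra A]
  (E : Type v) [NormedAddCommGroup E] [InnerProductSpace ℂ E] [CompleteSpace E]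

variable (A) in
/-- The space of representations of `A` on `E` with the topology of pointwise norm convergence. -/
def RepSpace : Type (max u v) := A →⋆ₐ[ℂ] (E →L[ℂ] E)

instance : FunLike (RepSpace A E) A (E →L[ℂ] E) :=
  inferInstanceAs (FunLike (A →⋆ₐ[ℂ] (E →L[ℂ] E)) A (E →L[ℂ] E))

instance : AlgHomClass (RepSpace A E) ℂ A (E →L[ℂ] E) :=
  inferInstanceAs (AlgHomClass (A →⋆ₐ[ℂ] (E →L[ℂ] E)) ℂ A (E →L[ℂ] E))

instance : StarHomClass (RepSpace A E) A (E →L[ℂ] E) :=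
  inferInstanceAs (StarHomClass (A →⋆ₐ[ℂ] (E →L[ℂ] E)) A (E →L[ℂ] E))

instance : TopologicalSpace (RepSpace A E) := .induced (fun ρ a => ρ a) inferInstance

variable {E}

theorem RepSpace.continuous_iff {X : Type*} [TopologicalSpace X] {f : X → RepSpace A E} :
    Continuous f ↔ ∀ a, Continuous fun x => f x a := by
  rw [continuous_induced_rng, continuous_pi_iff]; rfl

theorem RepSpace.continuous_apply (a : A) : Continuous fun ρ : RepSpace A E => ρ a :=
  RepSpace.continuous_iff.1 continuous_id a

theorem RepSpace.isEmbedding : Topology.IsEmbedding fun (ρ : RepSpace A E) (a : A) => ρ a :=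
  ⟨⟨rfl⟩, DFunLike.coe_injective⟩

instance : T2Space (RepSpace A E) := RepSpace.isEmbedding.t2Space

instance [FiniteDimensional ℂ E] : CompactSpace (RepSpace A E) := by
  have : ProperSpace (E →L[ℂ] E) := FiniteDimensional.proper ℂ _
  rw [← isCompact_univ_iff, RepSpace.isEmbedding.isCompact_iff, Set.image_univ]
  have h1 : IsCompact (Set.pi Set.univ fun a : A => Metric.closedBall (0 : E →L[ℂ] E) ‖a‖) :=
    isCompact_univ_pi fun a => isCompact_closedBall _ _
  refine h1.of_isClosed_subset ?_ ?_
  · have : Set.range (fun (ρ : RepSpace A E) (a : A) => ρ a) =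
        (⋂ (a : A) (b : A), {f | f (a + b) = f a + f b}) ∩
        (⋂ (a : A) (b : A), {f | f (a * b) = f a * f b}) ∩
        (⋂ c : ℂ, {f | f (algebraMap ℂ A c) = algebraMap ℂ _ c}) ∩
        (⋂ a : A, {f | f (star a) = star (f a)}) := by
      ext f
      simp only [Set.mem_inter_iff, Set.mem_iInter, Set.mem_ofPred_eq]
      constructor
      · rintro ⟨ρ, rfl⟩
        exact ⟨⟨⟨map_add ρ, map_mul ρ⟩, fun c => AlgHomClass.commutes ρ c⟩, map_star ρ⟩
      · rintro ⟨⟨⟨hadd, hmul⟩, hcomm⟩, hstar⟩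
        let ρ : A →⋆ₐ[ℂ] (E →L[ℂ] E) :=
          { toFun := f
            map_one' := by simpa using hcomm 1
            map_mul' := hmul
            map_zero' := by simpa using hcomm 0
            map_add' := hadd
            commutes' := hcomm
            map_star' := hstar }
        exact ⟨ρ, rfl⟩
    rw [this]
    refine (((isClosed_iInter fun a => isClosed_iInter fun b => ?_).inter
      (isClosed_iInter fun a => isClosed_iInter fun b => ?_)).inter
      (isClosed_iInter fun c => ?_)).inter (isClosed_iInter fun a => ?_)
    all_goals exact isClosed_eq (by fun_prop) (by fun_prop)
  · rintro _ ⟨ρ, rfl⟩ a -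
    simpa using NonUnitalStarAlgHom.norm_apply_le (ρ : A →⋆ₐ[ℂ] (E →L[ℂ] E)) a

theorem StarAlgHom.continuous_of_cstar {D : Type*} [CStarAlgebra D] (σ : A →⋆ₐ[ℂ] D) :
    Continuous σ :=
  AddMonoidHomClass.continuous_of_bound σ 1 fun a => by
    simpa using NonUnitalStarAlgHom.norm_apply_le σ a

/-- If `b` is small under `ρ` and large under `σ`, a cutdown of `b` vanishes under `ρ` only. -/
theorem exists_cutdown {D : Type*} [CStarAlgebra D] (σ : A →⋆ₐ[ℂ] D) {a : A} (ha : σ a ≠ 0) :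
    ∃ y : A, σ y ≠ 0 ∧ ∃ ε > 0, ∀ ρ : RepSpace A E, ‖ρ (star a * a)‖ < ε → ρ y = 0 := by
  set b := star a * a with hb
  have hbsa : IsSelfAdjoint b := .star_mul_self a
  have hσb : σ b ≠ 0 := by
    rw [hb, map_mul, map_star]
    exact fun h => ha ((CStarRing.star_mul_self_eq_zero_iff _).1 h)
  set δ := ‖σ b‖ / 2 with hδ
  have hδ0 : 0 < δ := half_pos (norm_pos_iff.2 hσb)
  -- `f` vanishes exactly on `[-δ, δ]`. This interval contains the spectrum of `ρ b` when `‖ρ b‖ <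
  -- δ`. If `σ (f b)` vanished, then `σ b` would equal its truncation to the interval, of norm at
  -- most `δ = ‖σ b‖ / 2`.
  let f : ℝ → ℝ := fun r => r - max (-δ) (min r δ)
  have hf : Continuous f := by fun_prop
  have hsa : IsSelfAdjoint (σ b) := hbsa.map σ
  refine ⟨cfc f b, fun h => ?_, δ, hδ0, fun ρ hρ => ?_⟩
  · rw [StarAlgHom.map_cfc σ f b hf.continuousOn σ.continuous_of_cstar hbsa hsa] at h
    have h1 : σ b = cfc (fun r => max (-δ) (min r δ)) (σ b) := by
      have h2 := cfc_sub (fun r : ℝ => r) f (σ b) continuousOn_id hf.continuousOn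
      rw [h, cfc_id' ℝ (σ b), sub_zero] at h2
      refine h2.symm.trans (congrArg (fun g => cfc g (σ b)) (funext fun r => ?_))
      simp [f]
    have h3 : ‖σ b‖ ≤ δ := by
      rw [h1]
      refine norm_cfc_le hδ0.le fun r _ => ?_
      rw [Real.norm_eq_abs, abs_le]
      exact ⟨le_max_left _ _, max_le (by linarith) (min_le_right _ _)⟩
    have := norm_pos_iff.2 hσb
    linarith
  · let ρ' : A →⋆ₐ[ℂ] (E →L[ℂ] E) := ρ
    change ρ' (cfc f b) = 0
    have hsa : IsSelfAdjoint (ρ' b) := hbsa.map ρ'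
    rw [StarAlgHom.map_cfc ρ' f b hf.continuousOn ρ'.continuous_of_cstar hbsa hsa,
      ← cfc_zero ℝ (ρ' b)]
    refine cfc_congr fun r hr => ?_
    have h1 : |r| ≤ δ := by
      refine (spectrum.norm_le_norm_mul_of_mem hr).trans (le_trans ?_ hρ.le)
      exact mul_le_of_le_one_right (norm_nonneg _) ContinuousLinearMap.norm_id_le
    obtain ⟨h2, h3⟩ := abs_le.1 h1
    simp [f, h2, h3]

/-- A compactness argument with a prime kernel. If no single `ρ ∈ T` works, each has a neighbourhood
on which some cutdown outside `ker σ` vanishes. Finitely many of these neighbourhoods cover `T`, and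
primeness combines the cutdowns into one product outside `ker σ` that vanishes on all of `T`. -/
theorem exists_ker_le_of_isCompact [FiniteDimensional ℂ E] {D : Type*} [CStarAlgebra D]
    [Nontrivial D] (σ : A →⋆ₐ[ℂ] D)
    (hσ : ∀ a b, σ a ≠ 0 → σ b ≠ 0 → ∃ c, σ (a * c * b) ≠ 0) {T : Set (RepSpace A E)}
    (hT : IsCompact T) (h : ∀ a, (∀ ρ ∈ T, ρ a = 0) → σ a = 0) :
    ∃ ρ ∈ T, ∀ a, ρ a = 0 → σ a = 0 := by
  by_contra! hcon
  obtain ⟨y, hy, hyT⟩ : ∃ y, σ y ≠ 0 ∧ ∀ ρ ∈ T, ρ y = 0 := by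
    refine hT.induction_on (p := fun T => ∃ y, σ y ≠ 0 ∧ ∀ ρ ∈ T, ρ y = 0) ?_ ?_ ?_ ?_
    · exact ⟨1, by simp, by simp⟩
    · rintro s t hst ⟨y, hy, hyt⟩
      exact ⟨y, hy, fun ρ hρ => hyt ρ (hst hρ)⟩
    · rintro s t ⟨y, hy, hys⟩ ⟨z, hz, hzt⟩
      obtain ⟨c, hc⟩ := hσ y z hy hz
      refine ⟨_, hc, ?_⟩
      rintro ρ (hρ | hρ)
      · simp [map_mul, hys ρ hρ]
      · simp [map_mul, hzt ρ hρ]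
    · intro ρ hρ
      obtain ⟨a, ha, hσa⟩ := hcon ρ hρ
      obtain ⟨y, hy, ε, hε, hyε⟩ := exists_cutdown (E := E) σ hσa
      refine ⟨{ρ | ‖ρ (star a * a)‖ < ε}, mem_nhdsWithin_of_mem_nhds
        ((isOpen_lt (RepSpace.continuous_apply _).norm continuous_const).mem_nhds ?_), y, hy,
        fun ρ hρ => hyε ρ hρ⟩
      simpa [map_mul, ha] using hε
  exact hy (h y hyT)

end Compactness

/-! ### Proper images -/

section Proper

variable {X Y : Type*} [TopologicalSpace X] [TopologicalSpace Y] {f : X → Y}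

/-- Two fibres are disjoint compact sets, so they have disjoint neighbourhoods. Since `f` is closed,
each of these contains the preimage of a neighbourhood of the point below. -/
theorem IsProperMap.t2Space_of_surjective [T2Space X] (hf : IsProperMap f)
    (hs : Function.Surjective f) : T2Space Y := by
  refine ⟨fun x y hxy => ?_⟩
  have hfib : ∀ y, IsCompact (f ⁻¹' {y}) := fun y => hf.isCompact_preimage isCompact_singleton
  obtain ⟨U, V, hU, hV, hxU, hyV, hd⟩ := SeparatedNhds.of_isCompact_isCompact (hfib x) (hfib y)
    (Disjoint.preimage f (Set.disjoint_singleton.2 hxy))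
  refine ⟨(f '' Uᶜ)ᶜ, (f '' Vᶜ)ᶜ, (hf.isClosedMap _ hU.isClosed_compl).isOpen_compl,
    (hf.isClosedMap _ hV.isClosed_compl).isOpen_compl, ?_, ?_, ?_⟩
  · rintro ⟨z, hz, rfl⟩
    exact hz (hxU rfl)
  · rintro ⟨z, hz, rfl⟩
    exact hz (hyV rfl)
  · refine Set.disjoint_left.2 fun z hz1 hz2 => ?_
    obtain ⟨w, rfl⟩ := hs z
    have hw1 : w ∈ U := by
      by_contra h
      exact hz1 ⟨w, h, rfl⟩
    have hw2 : w ∈ V := by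
      by_contra h
      exact hz2 ⟨w, h, rfl⟩
    exact Set.disjoint_left.1 hd hw1 hw2

theorem IsProperMap.weaklyLocallyCompactSpace_of_surjective [WeaklyLocallyCompactSpace X]
    (hf : IsProperMap f) (hs : Function.Surjective f) : WeaklyLocallyCompactSpace Y := by
  refine ⟨fun y => ?_⟩
  obtain ⟨K, hK, hKy⟩ := exists_compact_superset
    (hf.isCompact_preimage (isCompact_singleton (x := y)))
  refine ⟨f '' K, hK.image hf.continuous, Filter.mem_of_superset
    ((hf.isClosedMap _ isOpen_interior.isClosed_compl).isOpen_compl.mem_nhds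
      (x := y) (s := (f '' (interior K)ᶜ)ᶜ) ?_) fun z hz => ?_⟩
  · rintro ⟨z, hz, rfl⟩
    exact hz (hKy rfl)
  · obtain ⟨w, rfl⟩ := hs z
    refine ⟨w, interior_subset ?_, rfl⟩
    by_contra h
    exact hz ⟨w, h, rfl⟩

end Proper

/-! ### The space of primitive ideals of a given dimension -/

section PrimOfDim

open Set

variable {A : Type u} [CStarAlgebra A]

/-- Transport along a unitary realises all irreducible representations of one dimension on one fixed
space. This is what makes `Prim_d A` a quotient of a space of representations. -/
theorem exists_surjective_of_finrank_eq {H : Type*} [NormedAddCommGroup H] [InnerProductSpace ℂ H]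
    [CompleteSpace H] [FiniteDimensional ℂ H] {E : Type*} [NormedAddCommGroup E]
    [InnerProductSpace ℂ E] [CompleteSpace E] [FiniteDimensional ℂ E]
    (h : Module.finrank ℂ H = Module.finrank ℂ E) {π : A →⋆ₐ[ℂ] (H →L[ℂ] H)}
    (hπ : IsIrreducibleRep π) :
    ∃ ρ : A →⋆ₐ[ℂ] (E →L[ℂ] E), Function.Surjective ρ ∧ ∀ a, ρ a = 0 ↔ π a = 0 := by
  let e : H ≃ₗᵢ[ℂ] E := (stdOrthonormalBasis ℂ H).equiv (stdOrthonormalBasis ℂ E) (finCongr h)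
  refine ⟨(e.conjStarAlgEquiv : (H →L[ℂ] H) →⋆ₐ[ℂ] (E →L[ℂ] E)).comp π,
    e.conjStarAlgEquiv.surjective.comp hπ.surjective, fun a => ?_⟩
  exact map_eq_zero_iff e.conjStarAlgEquiv e.conjStarAlgEquiv.injective

variable {E : Type u} [NormedAddCommGroup E] [InnerProductSpace ℂ E] [CompleteSpace E]

variable (A E) in
/-- The surjective (that is, irreducible) representations of `A` on `E`. -/
def irrSpace : Set (RepSpace A E) := {ρ | Function.Surjective ρ}

/-- A dimension count: if `s` is a linear section of `σ`, then `ρ ∘ s` is an injective endomorphism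
of a finite-dimensional space, hence surjective. -/
theorem irrSpace.linear_surjective_of_ker_le [FiniteDimensional ℂ E] {ρ σ : A →⋆ₐ[ℂ] (E →L[ℂ] E)}
    (hσ : Function.Surjective σ) (h : ∀ a, ρ a = 0 → σ a = 0) : Function.Surjective ρ := by
  let ρ' : A →ₗ[ℂ] (E →L[ℂ] E) := (ρ : A →ₐ[ℂ] (E →L[ℂ] E)).toLinearMap
  let σ' : A →ₗ[ℂ] (E →L[ℂ] E) := (σ : A →ₐ[ℂ] (E →L[ℂ] E)).toLinearMap
  obtain ⟨s, hs⟩ := σ'.exists_rightInverse_of_surjective (LinearMap.range_eq_top.2 hσ)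
  have hinj : Function.Injective (ρ' ∘ₗ s) := by
    rw [← LinearMap.ker_eq_bot, LinearMap.ker_eq_bot']
    intro T hT
    have h1 : σ' (s T) = 0 := h _ hT
    rwa [← LinearMap.comp_apply, hs] at h1
  exact .of_comp (g := s) (LinearMap.injective_iff_surjective.1 hinj)

theorem ker_eq_of_ker_le [FiniteDimensional ℂ E] [Nontrivial E] {ρ σ : A →⋆ₐ[ℂ] (E →L[ℂ] E)}
    (hρ : Function.Surjective ρ) (h : ∀ a, ρ a = 0 → σ a = 0) (a : A) : ρ a = 0 ↔ σ a = 0 := by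
  obtain ⟨θ, hθ, hσ⟩ := exists_factor hρ (σ : A →ₐ[ℂ] (E →L[ℂ] E)) h
  have : σ a = θ (ρ a) := hσ a
  rw [this, map_eq_zero_iff θ hθ]

/-- Choose finitely many elements of `A` whose images under `ρ` form a basis of the operators.
Linear independence of the images persists for nearby representations, and an independent family of
this size spans. -/
theorem isOpen_irrSpace [FiniteDimensional ℂ E] : IsOpen (irrSpace A E) := by
  refine isOpen_iff_mem_nhds.2 fun ρ (hρ : Function.Surjective ρ) => ?_
  let b := Module.finBasis ℂ (E →L[ℂ] E)
  choose a ha using fun i => hρ (b i)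
  have hopen : IsOpen {ρ' : RepSpace A E | LinearIndependent ℂ fun i => ρ' (a i)} :=
    isOpen_setOfPred_linearIndependent.preimage
      (continuous_pi fun i => RepSpace.continuous_apply (a i))
  refine Filter.mem_of_superset (hopen.mem_nhds ?_) fun ρ' hρ' => ?_
  · change LinearIndependent ℂ fun i => ρ (a i)
    simp only [ha]
    exact b.linearIndependent
  · have hspan := LinearIndependent.span_eq_top_of_card_eq_finrank' hρ' (by simp)
    let ρ'' : A →ₗ[ℂ] (E →L[ℂ] E) := (AlgHomClass.toAlgHom ρ').toLinearMap
    have : LinearMap.range ρ'' = ⊤ := by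
      rw [← top_le_iff, ← hspan, Submodule.span_le]
      rintro _ ⟨i, rfl⟩
      exact ⟨a i, rfl⟩
    exact LinearMap.range_eq_top.1 this

/-- Evaluation on a dense sequence is injective and continuous from a compact space to a second
countable one, hence an embedding. This is the source of σ-compactness of the open subset
`irrSpace`. -/
instance [TopologicalSpace.SeparableSpace A] [FiniteDimensional ℂ E] :
    SecondCountableTopology (RepSpace A E) := by
  have : ProperSpace (E →L[ℂ] E) := FiniteDimensional.proper ℂ _
  let f : RepSpace A E → ℕ → (E →L[ℂ] E) := fun ρ n => ρ (TopologicalSpace.denseSeq A n)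
  have hf : Continuous f := continuous_pi fun n => RepSpace.continuous_apply _
  have hinj : Function.Injective f := fun ρ σ h => DFunLike.ext' <|
    (TopologicalSpace.denseRange_denseSeq A).equalizer
      (StarAlgHom.continuous_of_cstar (ρ : A →⋆ₐ[ℂ] (E →L[ℂ] E)))
      (StarAlgHom.continuous_of_cstar (σ : A →⋆ₐ[ℂ] (E →L[ℂ] E))) h
  exact (hf.isClosedEmbedding hinj).isEmbedding.secondCountableTopology

variable [FiniteDimensional ℂ E] [Nontrivial E] {d : ℕ}

/-- The kernel of an irreducible representation, as a point of `Prim_d A`. -/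
def irrSpace.toPrim (hE : Module.finrank ℂ E = d) (ρ : irrSpace A E) : primOfDim A d :=
  have hρ : IsIrreducibleRep (ρ.1 : A →⋆ₐ[ℂ] (E →L[ℂ] E)) := isIrreducibleRep_of_surjective ρ.2
  ⟨⟨RingHom.ker (ρ.1 : A →⋆ₐ[ℂ] (E →L[ℂ] E)), E, _, _, _, _, hρ, rfl⟩,
    E, _, _, _, _, hρ, inferInstance, hE, rfl⟩

variable (hE : Module.finrank ℂ E = d)

theorem irrSpace.mem_toPrim (ρ : irrSpace A E) (a : A) :
    a ∈ (irrSpace.toPrim hE ρ).1.1 ↔ ρ.1 a = 0 := Iff.rfl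

theorem irrSpace.toPrim_eq_iff (ρ σ : irrSpace A E) :
    irrSpace.toPrim hE ρ = irrSpace.toPrim hE σ ↔ ∀ a, ρ.1 a = 0 ↔ σ.1 a = 0 := by
  constructor
  · intro h a
    rw [← irrSpace.mem_toPrim hE, ← irrSpace.mem_toPrim hE, h]
  · exact fun h => Subtype.ext (Subtype.ext (Ideal.ext h))

theorem irrSpace.toPrim_surjective :
    Function.Surjective (irrSpace.toPrim (A := A) hE) := by
  rintro ⟨P, H, _, _, _, π, hπ, hfin, hd, hP⟩
  obtain ⟨ρ, hρ, hker⟩ := exists_surjective_of_finrank_eq (E := E) (hd.trans hE.symm) hπ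
  refine ⟨⟨ρ, hρ⟩, Subtype.ext (Subtype.ext ?_)⟩
  rw [← hP]
  exact Ideal.ext hker

theorem isOpen_setOf_notMem (A : Type u) [CStarAlgebra A] (d : ℕ) (a : A) :
    IsOpen {P : primOfDim A d | a ∉ P.1.1} := by
  have h : IsOpen {P : PrimitiveSpectrum A | a ∉ P.1} := ⟨{a}, by simp⟩
  exact h.preimage continuous_subtype_val

theorem continuous_primOfDim_iff {X : Type*} [TopologicalSpace X] {f : X → primOfDim A d} :
    Continuous f ↔ ∀ a, IsOpen {x | a ∉ (f x).1.1} := by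
  refine ⟨fun h a => (isOpen_setOf_notMem A d a).preimage h, fun h => ?_⟩
  rw [continuous_induced_rng]
  refine ⟨?_⟩
  rintro _ ⟨F, rfl⟩
  have : (Subtype.val ∘ f) ⁻¹' {P | ∃ a ∈ F, a ∉ P.1} = ⋃ a ∈ F, {x | a ∉ (f x).1.1} := by
    ext x; simp
  rw [this]
  exact isOpen_biUnion fun a _ => h a

theorem irrSpace.continuous_toPrim : Continuous (irrSpace.toPrim (A := A) hE) :=
  continuous_primOfDim_iff.2 fun a =>
    isOpen_ne_fun ((RepSpace.continuous_apply a).comp continuous_subtype_val) continuous_const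

/-- If `ker σ` is in the closure of the image of `Z`, it contains everything that vanishes on the
closure of `Z` among all representations. That closure is compact, so `ker ρ ⊆ ker σ` for a single
`ρ` in it. Having `σ` surjective on the same space forces `ρ` to be surjective with the same kernel,
so `ρ ∈ Z`. -/
theorem irrSpace.isClosedMap_toPrim : IsClosedMap (irrSpace.toPrim (A := A) hE) := by
  intro Z hZ
  refine isClosed_of_closure_subset fun P hP => ?_
  obtain ⟨σ, rfl⟩ := irrSpace.toPrim_surjective hE P
  have hPk : IsPrimitiveIdeal (RingHom.ker (σ.1 : A →⋆ₐ[ℂ] (E →L[ℂ] E))) :=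
    ⟨E, _, _, _, _, isIrreducibleRep_of_surjective σ.2, rfl⟩
  obtain ⟨ρ, hρ, hker⟩ := exists_ker_le_of_isCompact (σ.1 : A →⋆ₐ[ℂ] (E →L[ℂ] E))
    (fun a b ha hb => hPk.exists_mul_mul_notMem ha hb)
    (isClosed_closure (s := Subtype.val '' Z)).isCompact (fun a ha => by
      by_contra hσ
      obtain ⟨_, h1, ⟨ρ, hρ, rfl⟩⟩ := mem_closure_iff.1 hP _ (isOpen_setOf_notMem A d a) hσ
      exact h1 (ha ρ.1 (subset_closure ⟨ρ, hρ, rfl⟩)))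
  have hsurj : Function.Surjective ρ := irrSpace.linear_surjective_of_ker_le
    (ρ := (ρ : A →⋆ₐ[ℂ] (E →L[ℂ] E))) (σ := (σ.1 : A →⋆ₐ[ℂ] (E →L[ℂ] E))) σ.2 hker
  refine ⟨⟨ρ, hsurj⟩, ?_, (irrSpace.toPrim_eq_iff hE _ _).2
    (ker_eq_of_ker_le (ρ := (ρ : A →⋆ₐ[ℂ] (E →L[ℂ] E)))
      (σ := (σ.1 : A →⋆ₐ[ℂ] (E →L[ℂ] E))) hsurj hker)⟩
  rw [← hZ.closure_eq, closure_subtype]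
  exact hρ

theorem irrSpace.isProperMap_toPrim : IsProperMap (irrSpace.toPrim (A := A) hE) := by
  refine isProperMap_iff_isClosedMap_and_compact_fibers.2 ⟨irrSpace.continuous_toPrim hE,
    irrSpace.isClosedMap_toPrim hE, fun P => ?_⟩
  obtain ⟨σ, rfl⟩ := irrSpace.toPrim_surjective hE P
  rw [Topology.IsEmbedding.subtypeVal.isCompact_iff]
  -- Vanishing on `ker σ` already implies surjectivity and equality of kernels, so the fibre is
  -- closed in the compact space of all representations, not merely in the open part.
  have : Subtype.val '' (irrSpace.toPrim hE ⁻¹' {irrSpace.toPrim hE σ}) =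
      ⋂ (a : A) (_ : σ.1 a = 0), {ρ : RepSpace A E | ρ a = 0} := by
    ext ρ
    simp only [mem_image, mem_preimage, mem_singleton_iff, mem_iInter, mem_ofPred_eq]
    constructor
    · rintro ⟨ρ, h, rfl⟩ a ha
      exact ((irrSpace.toPrim_eq_iff hE _ _).1 h a).2 ha
    · intro h
      have hker := ker_eq_of_ker_le (ρ := (σ.1 : A →⋆ₐ[ℂ] (E →L[ℂ] E)))
        (σ := (ρ : A →⋆ₐ[ℂ] (E →L[ℂ] E))) σ.2 h
      exact ⟨⟨ρ, irrSpace.linear_surjective_of_ker_le (ρ := (ρ : A →⋆ₐ[ℂ] (E →L[ℂ] E)))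
        (σ := (σ.1 : A →⋆ₐ[ℂ] (E →L[ℂ] E))) σ.2 fun a => (hker a).2⟩,
        (irrSpace.toPrim_eq_iff hE _ _).2 fun a => (hker a).symm, rfl⟩
  rw [this]
  exact (isClosed_iInter fun a => isClosed_iInter fun _ =>
    isClosed_eq (RepSpace.continuous_apply a) continuous_const).isCompact

/-- A `d`-dimensional Hilbert space in a given universe. -/
abbrev StdHilbert (d : ℕ) : Type u := EuclideanSpace ℂ (ULift.{u} (Fin d))

theorem finrank_stdHilbert (d : ℕ) : Module.finrank ℂ (StdHilbert.{u} d) = d := by simp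

theorem pos_of_primOfDim (P : primOfDim A d) : 0 < d := by
  obtain ⟨P, H, _, _, _, π, hπ, _, rfl, -⟩ := P
  have := hπ.nontrivial
  exact Module.finrank_pos

theorem nontrivial_stdHilbert (hd : 0 < d) : Nontrivial (StdHilbert.{u} d) :=
  Module.nontrivial_of_finrank_pos (R := ℂ) (by rwa [finrank_stdHilbert])

instance : T2Space (primOfDim A d) := by
  rcases isEmpty_or_nonempty (primOfDim A d) with h | ⟨⟨P⟩⟩
  · exact ⟨fun x => h.elim x⟩
  have := nontrivial_stdHilbert.{u} (pos_of_primOfDim P)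
  exact (irrSpace.isProperMap_toPrim (finrank_stdHilbert.{u} d)).t2Space_of_surjective
    (irrSpace.toPrim_surjective _)

instance : WeaklyLocallyCompactSpace (primOfDim A d) := by
  rcases isEmpty_or_nonempty (primOfDim A d) with h | ⟨⟨P⟩⟩
  · exact ⟨fun x => h.elim x⟩
  have := nontrivial_stdHilbert.{u} (pos_of_primOfDim P)
  have := (isOpen_irrSpace (A := A) (E := StdHilbert.{u} d)).locallyCompactSpace
  exact (irrSpace.isProperMap_toPrim
    (finrank_stdHilbert.{u} d)).weaklyLocallyCompactSpace_of_surjective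
    (irrSpace.toPrim_surjective _)

instance [TopologicalSpace.SeparableSpace A] : SigmaCompactSpace (primOfDim A d) := by
  rcases isEmpty_or_nonempty (primOfDim A d) with h | ⟨⟨P⟩⟩
  · infer_instance
  have := nontrivial_stdHilbert.{u} (pos_of_primOfDim P)
  have := (isOpen_irrSpace (A := A) (E := StdHilbert.{u} d)).locallyCompactSpace
  rw [← isSigmaCompact_univ_iff, ← (irrSpace.toPrim_surjective (A := A)
    (finrank_stdHilbert.{u} d)).range_eq]
  exact isSigmaCompact_range (irrSpace.continuous_toPrim _)

end PrimOfDim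

/-! ### Factor representations of subhomogeneous algebras -/

section Factor

theorem LinearMap.finiteDimensional_range_of_ker_le {V W W' : Type*} [AddCommGroup V] [Module ℂ V]
    [AddCommGroup W] [Module ℂ W] [AddCommGroup W'] [Module ℂ W'] [FiniteDimensional ℂ W]
    {f : V →ₗ[ℂ] W} {g : V →ₗ[ℂ] W'} (h : LinearMap.ker f ≤ LinearMap.ker g) :
    FiniteDimensional ℂ (LinearMap.range g) := by
  have : FiniteDimensional ℂ (V ⧸ LinearMap.ker f) := f.quotKerEquivRange.symm.finiteDimensional
  rw [← Submodule.range_liftQ (LinearMap.ker f) g h]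
  infer_instance

variable {C : Type u} [CStarAlgebra C] {H : Type w} [NormedAddCommGroup H] [InnerProductSpace ℂ H]
  [CompleteSpace H]

/-- A representation is factorial if there are no nontrivial closed subspaces invariant under
both the representation and its commutant. -/
def IsFactorRep (π : C →⋆ₐ[ℂ] (H →L[ℂ] H)) : Prop :=
  ∀ M : Submodule ℂ H, IsClosed (M : Set H) → (∀ c, ∀ x ∈ M, π c x ∈ M) →
    (∀ T : H →L[ℂ] H, (∀ c, Commute T (π c)) → ∀ x ∈ M, T x ∈ M) → M = ⊥ ∨ M = ⊤

/-- The vectors annihilated by a set stable under right multiplication form a closed subspace that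
is invariant under both the representation and its commutant. One nonzero such vector makes it
everything. -/
theorem IsFactorRep.forall_ker {π : C →⋆ₐ[ℂ] (H →L[ℂ] H)} (hπ : IsFactorRep π) {I : Set C}
    (hI : ∀ a ∈ I, ∀ c, a * c ∈ I) {x : H} (hx : x ≠ 0) (h : ∀ a ∈ I, π a x = 0) (a : C)
    (ha : a ∈ I) : π a = 0 := by
  let M : Submodule ℂ H :=
    { carrier := {x | ∀ a ∈ I, π a x = 0}
      add_mem' := fun hx hx' a ha => by simp [hx a ha, hx' a ha]
      zero_mem' := fun c => by simp
      smul_mem' := fun r x hx a ha => by simp [hx a ha] }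
  have hcl : IsClosed (M : Set H) := by
    have : (M : Set H) = ⋂ (a : C) (_ : a ∈ I), {x | π a x = 0} := by
      ext x; simp [M]
    rw [this]
    exact isClosed_iInter fun a => isClosed_iInter fun _ =>
      isClosed_eq (by fun_prop) continuous_const
  rcases hπ M hcl (fun c x hx a ha => by
      have := hx (a * c) (hI a ha c)
      simpa [map_mul] using this) (fun T hT x hx a ha => by
      have h1 : π a (T x) = T (π a x) := congrArg (fun S : H →L[ℂ] H => S x) (hT a).symm
      rw [h1, hx a ha, map_zero]) with hM | hM
  · have : x ∈ M := h
    rw [hM] at this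
    exact absurd this hx
  · ext y
    have : y ∈ M := hM ▸ Submodule.mem_top
    exact this a ha

theorem IsFactorRep.exists_mul_mul_ne_zero {π : C →⋆ₐ[ℂ] (H →L[ℂ] H)} (hπ : IsFactorRep π)
    {a b : C} (ha : π a ≠ 0) (hb : π b ≠ 0) : ∃ c, π (a * c * b) ≠ 0 := by
  by_contra! h
  obtain ⟨y, hy⟩ : ∃ y, π b y ≠ 0 := by
    by_contra! h0
    exact hb (ContinuousLinearMap.ext h0)
  refine ha (hπ.forall_ker (I := Set.range fun c => a * c) ?_ hy ?_ a ⟨1, mul_one a⟩)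
  · rintro _ ⟨c, rfl⟩ d
    exact ⟨c * d, (mul_assoc _ _ _).symm⟩
  · rintro _ ⟨c, rfl⟩
    have := congrArg (fun T : H →L[ℂ] H => T y) (h c)
    simpa [map_mul] using this

/-- Otherwise, for each `k`, compactness gives an element outside `ker π` that vanishes in all
representations on the `k`-dimensional space. As `ker π` is prime, such elements multiply to one
that vanishes in all dimensions up to the bound for `C`. This contradicts that irreducible
representations separate points. -/
theorem IsFactorRep.exists_ker_le [Nontrivial H] {π : C →⋆ₐ[ℂ] (H →L[ℂ] H)} (hπ : IsFactorRep π)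
    (hC : IsSubhomogeneous C) :
    ∃ (k : ℕ) (ρ : RepSpace C (StdHilbert.{u} k)), ∀ c, ρ c = 0 → π c = 0 := by
  by_contra! hcon
  have hk : ∀ k, ∃ y, π y ≠ 0 ∧ ∀ ρ : RepSpace C (StdHilbert.{u} k), ρ y = 0 := fun k => by
    by_contra! h
    obtain ⟨ρ, -, hρ⟩ := exists_ker_le_of_isCompact π
      (fun a b ha hb => hπ.exists_mul_mul_ne_zero ha hb)
      (isCompact_univ (X := RepSpace C (StdHilbert.{u} k))) (fun a ha => by
        by_contra hne
        obtain ⟨ρ, hρ⟩ := h a hne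
        exact hρ (ha ρ trivial))
    obtain ⟨c, h1, h2⟩ := hcon k ρ
    exact h2 (hρ c h1)
  have hn : ∀ n, ∃ y, π y ≠ 0 ∧ ∀ k < n, ∀ ρ : RepSpace C (StdHilbert.{u} k), ρ y = 0 := fun n => by
    induction n with
    | zero => exact ⟨1, by simp, by simp⟩
    | succ n ih =>
      obtain ⟨y, hy, hyn⟩ := ih
      obtain ⟨z, hz, hzn⟩ := hk n
      obtain ⟨c, hc⟩ := hπ.exists_mul_mul_ne_zero hy hz
      refine ⟨_, hc, fun k hkn ρ => ?_⟩
      rcases Nat.lt_succ_iff_lt_or_eq.1 hkn with h | rfl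
      · simp [map_mul, hyn k h ρ]
      · simp [map_mul, hzn ρ]
  obtain ⟨N, hN⟩ := hC
  obtain ⟨y, hy, hyN⟩ := hn (N + 1)
  obtain ⟨φ, hφ, hφy⟩ := exists_isIrreducibleRep_apply_ne_zero (x := y) (by rintro rfl; simp at hy)
  obtain ⟨_, hle⟩ := hN φ.Space φ.rep hφ
  obtain ⟨ρ, -, hρ⟩ := exists_surjective_of_finrank_eq
    (E := StdHilbert.{u} (Module.finrank ℂ φ.Space)) (finrank_stdHilbert _).symm hφ
  exact hφy ((hρ y).1 (hyN _ (Nat.lt_succ_of_le hle) ρ))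

/-- The restriction of a representation to an invariant subspace. -/
def StarAlgHom.restrictInvariant (π : C →⋆ₐ[ℂ] (H →L[ℂ] H)) (K : Submodule ℂ H) [CompleteSpace K]
    (hK : ∀ c, ∀ x ∈ K, π c x ∈ K) : C →⋆ₐ[ℂ] (K →L[ℂ] K) where
  toFun c := ((π c).comp K.subtypeL).codRestrict K fun x => hK c x x.2
  map_one' := by ext; simp
  map_mul' a b := by ext; simp; rfl
  map_zero' := by ext; simp
  map_add' a b := by ext; simp; rfl
  commutes' r := by ext; simp [Algebra.algebraMap_eq_smul_one]
  map_star' a := by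
    rw [ContinuousLinearMap.star_eq_adjoint, ContinuousLinearMap.eq_adjoint_iff]
    intro x y
    have := StarAlgHom.inner_apply_left π (star a) (x : H) (y : H)
    rw [star_star] at this
    exact this

theorem StarAlgHom.coe_restrictInvariant_apply (π : C →⋆ₐ[ℂ] (H →L[ℂ] H)) (K : Submodule ℂ H)
    [CompleteSpace K] (hK : ∀ c, ∀ x ∈ K, π c x ∈ K) (c : C) (x : K) :
    (π.restrictInvariant K hK c x : H) = π c x := rfl

/-- The orbit of a vector under a representation. -/
def StarAlgHom.orbit (π : C →⋆ₐ[ℂ] (H →L[ℂ] H)) (ξ : H) : Submodule ℂ H :=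
  LinearMap.range ((ContinuousLinearMap.apply ℂ H ξ).toLinearMap ∘ₗ
    (π : C →ₐ[ℂ] (H →L[ℂ] H)).toLinearMap)

theorem StarAlgHom.mem_orbit {π : C →⋆ₐ[ℂ] (H →L[ℂ] H)} {ξ x : H} :
    x ∈ π.orbit ξ ↔ ∃ c, π c ξ = x := Iff.rfl

theorem StarAlgHom.apply_mem_orbit (π : C →⋆ₐ[ℂ] (H →L[ℂ] H)) {ξ : H} (c : C) {x : H}
    (hx : x ∈ π.orbit ξ) : π c x ∈ π.orbit ξ := by
  obtain ⟨d, rfl⟩ := StarAlgHom.mem_orbit.1 hx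
  exact StarAlgHom.mem_orbit.2 ⟨c * d, by simp [map_mul]⟩

theorem StarAlgHom.self_mem_orbit (π : C →⋆ₐ[ℂ] (H →L[ℂ] H)) (ξ : H) : ξ ∈ π.orbit ξ :=
  StarAlgHom.mem_orbit.2 ⟨1, by simp⟩

theorem StarAlgHom.finiteDimensional_orbit {π : C →⋆ₐ[ℂ] (H →L[ℂ] H)} {E : Type*}
    [NormedAddCommGroup E] [InnerProductSpace ℂ E] [CompleteSpace E] [FiniteDimensional ℂ E]
    (ρ : C →⋆ₐ[ℂ] (E →L[ℂ] E)) (h : ∀ c, ρ c = 0 → π c = 0) (ξ : H) :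
    FiniteDimensional ℂ (π.orbit ξ) :=
  LinearMap.finiteDimensional_range_of_ker_le (f := (ρ : C →ₐ[ℂ] (E →L[ℂ] E)).toLinearMap)
    fun c hc => by
      have : π c = 0 := h c hc
      simp [this]

/-- Orbits are finite-dimensional, so there is a nonzero invariant subspace of least dimension, and
the restriction to it is irreducible. The kernel of this restriction annihilates a nonzero vector,
hence lies in `ker π` by `IsFactorRep.forall_ker`. -/
theorem IsFactorRep.exists_surjective [Nontrivial H] {π : C →⋆ₐ[ℂ] (H →L[ℂ] H)}
    (hπ : IsFactorRep π) (hC : IsSubhomogeneous C) :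
    ∃ (k : ℕ) (ρ : C →⋆ₐ[ℂ] (StdHilbert.{u} k →L[ℂ] StdHilbert.{u} k)), 0 < k ∧
      Function.Surjective ρ ∧ ∀ c, ρ c = 0 → π c = 0 := by
  obtain ⟨k, ρ, hρ⟩ := hπ.exists_ker_le hC
  obtain ⟨ξ, hξ⟩ := exists_ne (0 : H)
  let p : ℕ → Prop := fun n => ∃ K : Submodule ℂ H, FiniteDimensional ℂ K ∧ K ≠ ⊥ ∧
    (∀ c, ∀ x ∈ K, π c x ∈ K) ∧ Module.finrank ℂ K = n
  have hp : ∃ n, p n := ⟨_, π.orbit ξ, StarAlgHom.finiteDimensional_orbit ρ hρ ξ,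
    fun h => hξ (by simpa [h] using π.self_mem_orbit ξ), fun c x hx => π.apply_mem_orbit c hx, rfl⟩
  classical
  obtain ⟨K, _, hK0, hK, hKn⟩ := Nat.find_spec hp
  have hKc : CompleteSpace K := FiniteDimensional.complete ℂ K
  have hKnt : Nontrivial K := Submodule.nontrivial_iff_ne_bot.2 hK0
  have hirr : IsIrreducibleRep (π.restrictInvariant K hK) := by
    refine ⟨hKnt, fun M _ hM => ?_⟩
    by_contra! hne
    have hmin := Nat.find_min' hp (m := Module.finrank ℂ M) ⟨M.map K.subtype, inferInstance,
      fun h => hne.1 ((Submodule.map_injective_of_injective K.subtype_injective)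
        (by simpa using h)), ?_, ?_⟩
    · rw [← hKn] at hmin
      exact hne.2 (Submodule.eq_top_of_finrank_eq (le_antisymm (Submodule.finrank_le M) hmin))
    · rintro c _ ⟨x, hx, rfl⟩
      exact ⟨_, hM c x hx, rfl⟩
    · exact K.finrank_map_subtype_eq M
  obtain ⟨z, hz, hzker⟩ := exists_surjective_of_finrank_eq
    (E := StdHilbert.{u} (Module.finrank ℂ K)) (finrank_stdHilbert _).symm hirr
  refine ⟨_, z, Module.finrank_pos, hz, fun c hc => ?_⟩
  obtain ⟨⟨x, hxK⟩, hx0⟩ := exists_ne (0 : K)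
  refine hπ.forall_ker (I := {c | z c = 0}) (fun a ha c => ?_) (x := x)
    (fun h => hx0 (Subtype.ext h)) (fun a ha => ?_) c hc
  · change z (a * c) = 0
    rw [map_mul, show z a = 0 from ha, zero_mul]
  · have h1 : π.restrictInvariant K hK a = 0 := (hzker a).1 ha
    rw [← StarAlgHom.coe_restrictInvariant_apply π K hK a ⟨x, hxK⟩, h1]
    rfl

end Factor

/-! ### Elementary tensors -/

section OpTensor

variable {H K : Type*} [NormedAddCommGroup H] [InnerProductSpace ℂ H]
  [NormedAddCommGroup K] [InnerProductSpace ℂ K]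

theorem opTensor_coe (T : H →L[ℂ] H) (U : K →L[ℂ] K) (x : H ⊗[ℂ] K) :
    opTensor T U (x : HilbertTensor H K) =
      ((TensorProduct.mapL T U x : H ⊗[ℂ] K) : HilbertTensor H K) :=
  ContinuousLinearMap.completion_apply_coe _ _

theorem HilbertTensor.clm_ext {T U : HilbertTensor H K →L[ℂ] HilbertTensor H K}
    (h : ∀ x : H ⊗[ℂ] K, T (x : HilbertTensor H K) = U (x : HilbertTensor H K)) : T = U := by
  ext x
  induction x using UniformSpace.Completion.induction_on with
  | hp => exact isClosed_eq (by fun_prop) (by fun_prop)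
  | ih x => exact h x

theorem opTensor_mul (T T' : H →L[ℂ] H) (U U' : K →L[ℂ] K) :
    opTensor (T * T') (U * U') = opTensor T U * opTensor T' U' := by
  refine HilbertTensor.clm_ext fun x => ?_
  rw [opTensor_coe, TensorProduct.mapL_mul]
  change _ = opTensor T U (opTensor T' U' x)
  rw [opTensor_coe, opTensor_coe]
  rfl

theorem opTensor_one : opTensor (1 : H →L[ℂ] H) (1 : K →L[ℂ] K) = 1 := by
  refine HilbertTensor.clm_ext fun x => ?_
  rw [opTensor_coe]
  change ((TensorProduct.mapL (.id ℂ H) (.id ℂ K) x : H ⊗[ℂ] K) : HilbertTensor H K) = x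
  rw [TensorProduct.mapL_id_id]
  rfl

theorem opTensor_add_left (T T' : H →L[ℂ] H) (U : K →L[ℂ] K) :
    opTensor (T + T') U = opTensor T U + opTensor T' U := by
  refine HilbertTensor.clm_ext fun x => ?_
  rw [add_apply, opTensor_coe, opTensor_coe, opTensor_coe,
    TensorProduct.mapL_add_left, ← UniformSpace.Completion.coe_add]
  rfl

theorem opTensor_add_right (T : H →L[ℂ] H) (U U' : K →L[ℂ] K) :
    opTensor T (U + U') = opTensor T U + opTensor T U' := by
  refine HilbertTensor.clm_ext fun x => ?_
  rw [add_apply, opTensor_coe, opTensor_coe, opTensor_coe,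
    TensorProduct.mapL_add_right, ← UniformSpace.Completion.coe_add]
  rfl

theorem opTensor_smul_left (r : ℂ) (T : H →L[ℂ] H) (U : K →L[ℂ] K) :
    opTensor (r • T) U = r • opTensor T U := by
  refine HilbertTensor.clm_ext fun x => ?_
  rw [smul_apply, opTensor_coe, opTensor_coe,
    TensorProduct.mapL_smul_left, ← UniformSpace.Completion.coe_smul]
  rfl

theorem opTensor_smul_right (r : ℂ) (T : H →L[ℂ] H) (U : K →L[ℂ] K) :
    opTensor T (r • U) = r • opTensor T U := by
  refine HilbertTensor.clm_ext fun x => ?_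
  rw [smul_apply, opTensor_coe, opTensor_coe,
    TensorProduct.mapL_smul_right, ← UniformSpace.Completion.coe_smul]
  rfl

theorem TensorProduct.inner_mapL_star [CompleteSpace H] [CompleteSpace K] (T : H →L[ℂ] H)
    (U : K →L[ℂ] K) (x y : H ⊗[ℂ] K) :
    inner ℂ (TensorProduct.mapL (star T) (star U) x) y = inner ℂ x (TensorProduct.mapL T U y) := by
  induction x with
  | zero => simp
  | add x x' hx hx' => rw [map_add, inner_add_left, inner_add_left, hx, hx']
  | tmul a b =>
    induction y with
    | zero => simp
    | add y y' hy hy' => rw [map_add, inner_add_right, inner_add_right, hy, hy']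
    | tmul c d =>
      simp [ContinuousLinearMap.star_eq_adjoint, ContinuousLinearMap.adjoint_inner_left]

theorem opTensor_star [CompleteSpace H] [CompleteSpace K] (T : H →L[ℂ] H) (U : K →L[ℂ] K) :
    opTensor (star T) (star U) = star (opTensor T U) := by
  rw [ContinuousLinearMap.star_eq_adjoint (opTensor T U), ContinuousLinearMap.eq_adjoint_iff]
  intro x y
  induction x, y using UniformSpace.Completion.induction_on₂ with
  | hp => exact isClosed_eq (by fun_prop) (by fun_prop)
  | ih x y =>
    rw [opTensor_coe, opTensor_coe, UniformSpace.Completion.inner_coe,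
      UniformSpace.Completion.inner_coe, TensorProduct.inner_mapL_star]

end OpTensor

/-! ### Elementary tensors inside `C ⊗ S` -/

namespace CStarTensor

variable {C : Type u} {S : Type v} [CStarAlgebra C] [CStarAlgebra S]

/-- The representation of `C ⊗ S` on the tensor product of two GNS spaces. -/
def evalHom (φ : CStarState C) (ψ : CStarState S) :
    CStarTensor C S →⋆ₐ[ℂ] (HilbertTensor φ.Space ψ.Space →L[ℂ] HilbertTensor φ.Space ψ.Space) where
  toFun x := x.1 (φ, ψ)
  map_one' := rfl
  map_mul' _ _ := rfl
  map_zero' := rfl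
  map_add' _ _ := rfl
  commutes' _ := rfl
  map_star' _ := rfl

theorem ext_evalHom {x y : CStarTensor C S} (h : ∀ φ ψ, evalHom φ ψ x = evalHom φ ψ y) : x = y :=
  Subtype.ext (Subtype.ext (funext fun p => h p.1 p.2))

/-- The elementary tensor `c ⊗ s` as an element of `C ⊗ S`. -/
def tmul (c : C) (s : S) : CStarTensor C S :=
  ⟨elemTensor c s, subset_closure (StarAlgebra.subset_adjoin ℂ _ ⟨c, s, rfl⟩)⟩

theorem evalHom_tmul (φ : CStarState C) (ψ : CStarState S) (c : C) (s : S) :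
    evalHom φ ψ (tmul c s) = opTensor (φ.rep c) (ψ.rep s) := rfl

theorem tmul_mul_tmul (c c' : C) (s s' : S) : tmul c s * tmul c' s' = tmul (c * c') (s * s') :=
  ext_evalHom fun φ ψ => by simp only [map_mul, evalHom_tmul, opTensor_mul]

theorem star_tmul (c : C) (s : S) : star (tmul c s) = tmul (star c) (star s) :=
  ext_evalHom fun φ ψ => by simp only [map_star, evalHom_tmul, opTensor_star]

theorem one_tmul_one : tmul (1 : C) (1 : S) = 1 :=
  ext_evalHom fun φ ψ => by simp only [map_one, evalHom_tmul, opTensor_one]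

theorem add_tmul (c c' : C) (s : S) : tmul (c + c') s = tmul c s + tmul c' s :=
  ext_evalHom fun φ ψ => by simp only [map_add, evalHom_tmul, opTensor_add_left]

theorem tmul_add (c : C) (s s' : S) : tmul c (s + s') = tmul c s + tmul c s' :=
  ext_evalHom fun φ ψ => by simp only [map_add, evalHom_tmul, opTensor_add_right]

theorem smul_tmul (r : ℂ) (c : C) (s : S) : tmul (r • c) s = r • tmul c s :=
  ext_evalHom fun φ ψ => by simp only [map_smul, evalHom_tmul, opTensor_smul_left]

theorem tmul_smul (r : ℂ) (c : C) (s : S) : tmul c (r • s) = r • tmul c s :=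
  ext_evalHom fun φ ψ => by simp only [map_smul, evalHom_tmul, opTensor_smul_right]

variable (C S) in
/-- The embedding `c ↦ c ⊗ 1`. -/
def inl : C →⋆ₐ[ℂ] CStarTensor C S where
  toFun c := tmul c 1
  map_one' := one_tmul_one
  map_mul' a b := by rw [tmul_mul_tmul, one_mul]
  map_zero' := by simpa using smul_tmul (0 : ℂ) (0 : C) (1 : S)
  map_add' a b := add_tmul a b 1
  commutes' r := by
    rw [Algebra.algebraMap_eq_smul_one, smul_tmul, one_tmul_one, Algebra.algebraMap_eq_smul_one]
  map_star' a := by rw [star_tmul, star_one]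

variable (C S) in
/-- The embedding `s ↦ 1 ⊗ s`. -/
def inr : S →⋆ₐ[ℂ] CStarTensor C S where
  toFun s := tmul 1 s
  map_one' := one_tmul_one
  map_mul' a b := by rw [tmul_mul_tmul, one_mul]
  map_zero' := by simpa using tmul_smul (0 : ℂ) (1 : C) (0 : S)
  map_add' a b := tmul_add 1 a b
  commutes' r := by
    rw [Algebra.algebraMap_eq_smul_one, tmul_smul, one_tmul_one, Algebra.algebraMap_eq_smul_one]
  map_star' a := by rw [star_tmul, star_one]

theorem inl_apply (c : C) : inl C S c = tmul c 1 := rfl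

theorem inr_apply (s : S) : inr C S s = tmul 1 s := rfl

theorem inl_mul_inr (c : C) (s : S) : inl C S c * inr C S s = tmul c s := by
  rw [inl_apply, inr_apply, tmul_mul_tmul, mul_one, one_mul]

theorem inr_mul_inl (c : C) (s : S) : inr C S s * inl C S c = tmul c s := by
  rw [inl_apply, inr_apply, tmul_mul_tmul, mul_one, one_mul]

/-- The elementary tensors span a dense subspace. -/
theorem mem_of_isClosed {M : Submodule ℂ (CStarTensor C S)}
    (hM : IsClosed (M : Set (CStarTensor C S))) (h : ∀ c s, tmul c s ∈ M) (x : CStarTensor C S) :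
    x ∈ M := by
  let N : Submodule ℂ (CStarTensor C S) :=
    Submodule.span ℂ (Set.range fun p : C × S => tmul p.1 p.2)
  have hNM : N ≤ M := Submodule.span_le.2 (by rintro _ ⟨p, rfl⟩; exact h p.1 p.2)
  have hmul : N * N ≤ N := by
    rw [Submodule.span_mul_span, Submodule.span_le]
    rintro _ ⟨_, ⟨p, rfl⟩, _, ⟨q, rfl⟩, rfl⟩
    exact Submodule.subset_span ⟨(p.1 * q.1, p.2 * q.2), (tmul_mul_tmul _ _ _ _).symm⟩
  have hstar : ∀ y ∈ N, star y ∈ N := fun y hy => by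
    induction hy using Submodule.span_induction with
    | mem y hy =>
      obtain ⟨p, rfl⟩ := hy
      exact Submodule.subset_span ⟨(star p.1, star p.2), (star_tmul _ _).symm⟩
    | zero => simp
    | add y z _ _ hy hz => rw [star_add]; exact N.add_mem hy hz
    | smul r y _ hy => rw [star_smul]; exact N.smul_mem _ hy
  -- The span of the elementary tensors is closed under products and adjoints, so it exhausts the
  -- generated star subalgebra of the ambient product.
  have hadj : ∀ y : GNSTensorProd C S,
      y ∈ StarAlgebra.adjoin ℂ {x | ∃ (c : C) (s : S), x = elemTensor c s} →
      ∃ z ∈ N, z.1 = y := fun y hy => by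
    induction hy using StarAlgebra.adjoin_induction with
    | mem y hy =>
      obtain ⟨c, s, rfl⟩ := hy
      exact ⟨tmul c s, Submodule.subset_span ⟨(c, s), rfl⟩, rfl⟩
    | algebraMap r =>
      refine ⟨r • tmul 1 1, N.smul_mem r (Submodule.subset_span ⟨(1, 1), rfl⟩), ?_⟩
      rw [one_tmul_one, Algebra.algebraMap_eq_smul_one]
      rfl
    | add y z _ _ hy hz =>
      obtain ⟨y, hy, rfl⟩ := hy
      obtain ⟨z, hz, rfl⟩ := hz
      exact ⟨y + z, N.add_mem hy hz, rfl⟩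
    | mul y z _ _ hy hz =>
      obtain ⟨y, hy, rfl⟩ := hy
      obtain ⟨z, hz, rfl⟩ := hz
      exact ⟨y * z, hmul (Submodule.mul_mem_mul hy hz), rfl⟩
    | star y _ hy =>
      obtain ⟨y, hy, rfl⟩ := hy
      exact ⟨star y, hstar y hy, rfl⟩
  have hx : x ∈ closure (N : Set (CStarTensor C S)) := by
    refine closure_subtype.2 (closure_mono ?_ x.2)
    intro y hy
    obtain ⟨z, hz, rfl⟩ := hadj y hy
    exact ⟨z, hz, rfl⟩
  exact closure_minimal hNM hM hx

end CStarTensor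

/-! ### Tensor products of irreducible representations -/

section GNS

variable {A : Type u} [CStarAlgebra A] {E : Type*} [NormedAddCommGroup E] [InnerProductSpace ℂ E]
  [CompleteSpace E] [FiniteDimensional ℂ E]

/-- An irreducible finite-dimensional representation is equivalent to the GNS representation of
each of its vector states. -/
theorem exists_gns_equiv [Nontrivial E] {π : A →⋆ₐ[ℂ] (E →L[ℂ] E)} (hπ : Function.Surjective π) :
    ∃ (φ : CStarState A) (U : E ≃ₗᵢ[ℂ] φ.Space), ∀ a x, U (π a x) = φ.rep a (U x) := by
  obtain ⟨ξ, hξ⟩ := exists_norm_eq E zero_le_one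
  let φ := stateSet.toCStarState (vectorState_mem_stateSet π hξ)
  have hξ0 : ξ ≠ 0 := fun h => by simp [h] at hξ
  -- Both orbit maps have the same norm at each `a`, because `φ` is the vector state of `ξ`. So `L₁
  -- a ↦ L₂ a` is a well-defined isometry.
  let L₁ : A →ₗ[ℂ] E := (ContinuousLinearMap.apply ℂ E ξ).toLinearMap ∘ₗ
    (π : A →ₐ[ℂ] (E →L[ℂ] E)).toLinearMap
  let L₂ : A →ₗ[ℂ] φ.Space := (ContinuousLinearMap.apply ℂ φ.Space φ.vec).toLinearMap ∘ₗ
    (φ.rep : A →ₐ[ℂ] (φ.Space →L[ℂ] φ.Space)).toLinearMap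
  have hL₁ : ∀ a, L₁ a = π a ξ := fun _ => rfl
  have hL₂ : ∀ a, L₂ a = φ.rep a φ.vec := fun _ => rfl
  have hnorm : ∀ a, ‖L₂ a‖ = ‖L₁ a‖ := fun a => by
    have h : inner ℂ (L₂ a) (L₂ a) = inner ℂ (L₁ a) (L₁ a) := by
      rw [hL₂, hL₁, φ.inner_rep_vec, StarAlgHom.inner_apply_left]
      change inner ℂ ξ (π (star a * a) ξ) = _
      rw [map_mul]
      rfl
    rw [norm_eq_sqrt_re_inner (𝕜 := ℂ), norm_eq_sqrt_re_inner (𝕜 := ℂ), h]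
  have hsurj : Function.Surjective L₁ := fun y => by
    obtain ⟨a, ha⟩ := hπ (InnerProductSpace.rankOne ℂ y ξ)
    refine ⟨a, ?_⟩
    rw [hL₁, ha, InnerProductSpace.rankOne_apply, inner_self_eq_norm_sq_to_K, hξ]
    simp
  obtain ⟨s, hs⟩ := L₁.exists_rightInverse_of_surjective (LinearMap.range_eq_top.2 hsurj)
  have hs' : ∀ x, L₁ (s x) = x := fun x => congrArg (fun f : E →ₗ[ℂ] E => f x) hs
  have hU₀ : ∀ a, L₂ (s (L₁ a)) = L₂ a := fun a => by
    rw [← sub_eq_zero, ← map_sub, ← norm_eq_zero, hnorm, map_sub, hs', sub_self, norm_zero]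
  let U₀ : E →ₗᵢ[ℂ] φ.Space := ⟨L₂ ∘ₗ s, fun x => by
    rw [LinearMap.comp_apply, hnorm, hs']⟩
  -- The image of the isometry is complete, hence closed, and it contains the dense orbit of the
  -- cyclic vector.
  have hU₀s : Function.Surjective U₀ := by
    have hcl : IsClosed (Set.range U₀) := U₀.isometry.isClosedEmbedding.isClosed_range
    have hdense : DenseRange U₀ := φ.denseRange_rep_vec.mono (by
      rintro _ ⟨a, rfl⟩
      exact ⟨L₁ a, hU₀ a⟩)
    rw [← Set.range_eq_univ, ← hcl.closure_eq, hdense.closure_range]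
  refine ⟨φ, LinearIsometryEquiv.ofSurjective U₀ hU₀s, fun a x => ?_⟩
  obtain ⟨b, rfl⟩ := hsurj x
  change L₂ (s (π a (L₁ b))) = φ.rep a (L₂ (s (L₁ b)))
  have h1 : π a (L₁ b) = L₁ (a * b) := by rw [hL₁, hL₁, map_mul]; rfl
  rw [h1, hU₀, hU₀, hL₂, hL₂, map_mul]
  rfl

end GNS

section TensorRep

/-- The transport of a representation along a unitary. -/
def StarAlgHom.conj {A : Type*} [CStarAlgebra A] {H K : Type*} [NormedAddCommGroup H]
    [InnerProductSpace ℂ H] [CompleteSpace H] [NormedAddCommGroup K] [InnerProductSpace ℂ K]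
    [CompleteSpace K] (π : A →⋆ₐ[ℂ] (H →L[ℂ] H)) (e : H ≃ₗᵢ[ℂ] K) : A →⋆ₐ[ℂ] (K →L[ℂ] K) :=
  (e.conjStarAlgEquiv : (H →L[ℂ] H) →⋆ₐ[ℂ] (K →L[ℂ] K)).comp π

theorem StarAlgHom.conj_apply {A : Type*} [CStarAlgebra A] {H K : Type*} [NormedAddCommGroup H]
    [InnerProductSpace ℂ H] [CompleteSpace H] [NormedAddCommGroup K] [InnerProductSpace ℂ K]
    [CompleteSpace K] (π : A →⋆ₐ[ℂ] (H →L[ℂ] H)) (e : H ≃ₗᵢ[ℂ] K) (a : A) (x : K) :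
    π.conj e a x = e (π a (e.symm x)) := rfl

variable {E F : Type*} [NormedAddCommGroup E] [InnerProductSpace ℂ E]
  [NormedAddCommGroup F] [InnerProductSpace ℂ F] [FiniteDimensional ℂ E] [FiniteDimensional ℂ F]

instance : CompleteSpace (E ⊗[ℂ] F) := FiniteDimensional.complete ℂ _

/-- Linear maps on the operators on `E ⊗ F` can be prescribed on elementary tensors. -/
theorem exists_linearMap_mapL {D : Type*} [AddCommGroup D] [Module ℂ D]
    (f : (E →L[ℂ] E) →ₗ[ℂ] (F →L[ℂ] F) →ₗ[ℂ] D) :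
    ∃ m : (E ⊗[ℂ] F →L[ℂ] E ⊗[ℂ] F) →ₗ[ℂ] D, ∀ T U, m (TensorProduct.mapL T U) = f T U := by
  let eE := (LinearMap.toContinuousLinearMap (𝕜 := ℂ) (E := E) (F' := E))
  let eF := (LinearMap.toContinuousLinearMap (𝕜 := ℂ) (E := F) (F' := F))
  let e := homTensorHomEquiv ℂ E F E F
  refine ⟨TensorProduct.lift (f.compl₁₂ eE.toLinearMap eF.toLinearMap) ∘ₗ e.symm.toLinearMap ∘ₗ
    (LinearMap.toContinuousLinearMap (𝕜 := ℂ) (E := E ⊗[ℂ] F) (F' := E ⊗[ℂ] F)).symm.toLinearMap,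
    fun T U => ?_⟩
  have h : e.symm (TensorProduct.mapL T U : E ⊗[ℂ] F →ₗ[ℂ] E ⊗[ℂ] F) =
      (T : E →ₗ[ℂ] E) ⊗ₜ[ℂ] (U : F →ₗ[ℂ] F) := by
    rw [LinearEquiv.symm_apply_eq, TensorProduct.toLinearMap_mapL]
    simp [e]
  change TensorProduct.lift (f.compl₁₂ eE.toLinearMap eF.toLinearMap)
    (e.symm (TensorProduct.mapL T U : E ⊗[ℂ] F →ₗ[ℂ] E ⊗[ℂ] F)) = f T U
  rw [h, TensorProduct.lift.tmul]
  rfl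

theorem mapL_mem_span (X : E ⊗[ℂ] F →L[ℂ] E ⊗[ℂ] F) {M : Submodule ℂ (E ⊗[ℂ] F →L[ℂ] E ⊗[ℂ] F)}
    (hM : ∀ T U, TensorProduct.mapL T U ∈ M) : X ∈ M := by
  obtain ⟨t, ht⟩ := (homTensorHomEquiv ℂ E F E F).surjective (X : E ⊗[ℂ] F →ₗ[ℂ] E ⊗[ℂ] F)
  have hX : X = LinearMap.toContinuousLinearMap (homTensorHomEquiv ℂ E F E F t) := by
    rw [ht]; rfl
  rw [hX]
  clear hX ht
  induction t with
  | zero => simp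
  | add x y hx hy => rw [map_add, map_add]; exact M.add_mem hx hy
  | tmul T U =>
    have : LinearMap.toContinuousLinearMap (homTensorHomEquiv ℂ E F E F (T ⊗ₜ[ℂ] U)) =
        TensorProduct.mapL (LinearMap.toContinuousLinearMap T)
          (LinearMap.toContinuousLinearMap U) := by
      apply ContinuousLinearMap.coe_injective
      rw [TensorProduct.toLinearMap_mapL]
      simp
    rw [this]
    exact hM _ _

variable [CompleteSpace E] [CompleteSpace F]
  {C : Type u} {S : Type v} [CStarAlgebra C] [CStarAlgebra S]

theorem tensorRep_surjective {z : C →⋆ₐ[ℂ] (E →L[ℂ] E)} {w : S →⋆ₐ[ℂ] (F →L[ℂ] F)}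
    (hz : Function.Surjective z) (hw : Function.Surjective w)
    {ρ : CStarTensor C S →⋆ₐ[ℂ] (E ⊗[ℂ] F →L[ℂ] E ⊗[ℂ] F)}
    (hρ : ∀ c s, ρ (CStarTensor.tmul c s) = TensorProduct.mapL (z c) (w s)) :
    Function.Surjective ρ := fun X =>
  mapL_mem_span X (M := LinearMap.range
    (ρ : CStarTensor C S →ₐ[ℂ] (E ⊗[ℂ] F →L[ℂ] E ⊗[ℂ] F)).toLinearMap) fun T U => by
    obtain ⟨c, rfl⟩ := hz T
    obtain ⟨s, rfl⟩ := hw U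
    exact ⟨_, hρ c s⟩

variable [Nontrivial E] [Nontrivial F]

/-- `C ⊗ S` is built from GNS representations of states, so `z` and `w` are replaced by unitarily
equivalent GNS representations. Their tensor product is a coordinate of `C ⊗ S`, and it is
conjugated back to `E ⊗ F`. -/
theorem exists_tensorRep {z : C →⋆ₐ[ℂ] (E →L[ℂ] E)} {w : S →⋆ₐ[ℂ] (F →L[ℂ] F)}
    (hz : Function.Surjective z) (hw : Function.Surjective w) :
    ∃ ρ : CStarTensor C S →⋆ₐ[ℂ] (E ⊗[ℂ] F →L[ℂ] E ⊗[ℂ] F),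
      ∀ c s, ρ (CStarTensor.tmul c s) = TensorProduct.mapL (z c) (w s) := by
  obtain ⟨φ, U, hU⟩ := exists_gns_equiv hz
  obtain ⟨ψ, V, hV⟩ := exists_gns_equiv hw
  have := U.toLinearEquiv.finiteDimensional
  have := V.toLinearEquiv.finiteDimensional
  let W₀ : E ⊗[ℂ] F →ₗᵢ[ℂ] HilbertTensor φ.Space ψ.Space :=
    (UniformSpace.Completion.toComplₗᵢ (𝕜 := ℂ) (E := φ.Space ⊗[ℂ] ψ.Space)).comp
      (TensorProduct.congrIsometry U V).toLinearIsometry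
  have hcoe : Function.Surjective (UniformSpace.Completion.toComplₗᵢ (𝕜 := ℂ)
      (E := φ.Space ⊗[ℂ] ψ.Space)) := by
    have hcl := (UniformSpace.Completion.toComplₗᵢ (𝕜 := ℂ)
      (E := φ.Space ⊗[ℂ] ψ.Space)).isometry.isClosedEmbedding.isClosed_range
    rw [← Set.range_eq_univ, ← hcl.closure_eq]
    exact UniformSpace.Completion.denseRange_coe.closure_range
  let W : E ⊗[ℂ] F ≃ₗᵢ[ℂ] HilbertTensor φ.Space ψ.Space :=
    LinearIsometryEquiv.ofSurjective W₀ (hcoe.comp (TensorProduct.congrIsometry U V).surjective)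
  have hW : ∀ x y, W (x ⊗ₜ y) = ((U x ⊗ₜ[ℂ] V y : φ.Space ⊗[ℂ] ψ.Space) :
      HilbertTensor φ.Space ψ.Space) := fun _ _ => rfl
  refine ⟨(CStarTensor.evalHom φ ψ).conj W.symm, fun c s => ?_⟩
  apply ContinuousLinearMap.coe_injective
  refine TensorProduct.ext' fun x y => ?_
  change (CStarTensor.evalHom φ ψ).conj W.symm (CStarTensor.tmul c s) (x ⊗ₜ y) =
    TensorProduct.mapL (z c) (w s) (x ⊗ₜ y)
  rw [StarAlgHom.conj_apply, LinearIsometryEquiv.symm_symm, CStarTensor.evalHom_tmul,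
    TensorProduct.mapL_tmul, LinearIsometryEquiv.symm_apply_eq, hW, hW, opTensor_coe,
    TensorProduct.mapL_tmul, hU, hV]

instance : Nontrivial (E ⊗[ℂ] F) :=
  Module.nontrivial_of_finrank_pos (R := ℂ) (by
    rw [Module.finrank_tensorProduct]
    exact Nat.mul_pos Module.finrank_pos Module.finrank_pos)

/-- A representation of `C ⊗ S` whose restrictions vanish on the kernels of `z` and `w` has the
same kernel as `z ⊗ w`. -/
theorem tensorRep_ker {z : C →⋆ₐ[ℂ] (E →L[ℂ] E)} {w : S →⋆ₐ[ℂ] (F →L[ℂ] F)}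
    (hz : Function.Surjective z) (hw : Function.Surjective w)
    {ρ : CStarTensor C S →⋆ₐ[ℂ] (E ⊗[ℂ] F →L[ℂ] E ⊗[ℂ] F)}
    (hρ : ∀ c s, ρ (CStarTensor.tmul c s) = TensorProduct.mapL (z c) (w s))
    {D : Type*} [CStarAlgebra D] [Nontrivial D] (σ : CStarTensor C S →⋆ₐ[ℂ] D)
    (hσz : ∀ c, z c = 0 → σ (CStarTensor.inl C S c) = 0)
    (hσw : ∀ s, w s = 0 → σ (CStarTensor.inr C S s) = 0) (x : CStarTensor C S) :
    ρ x = 0 ↔ σ x = 0 := by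
  obtain ⟨θ, -, hθ⟩ := exists_factor hz
    ((σ.comp (CStarTensor.inl C S) : C →⋆ₐ[ℂ] D) : C →ₐ[ℂ] D) hσz
  obtain ⟨θ', -, hθ'⟩ := exists_factor hw
    ((σ.comp (CStarTensor.inr C S) : S →⋆ₐ[ℂ] D) : S →ₐ[ℂ] D) hσw
  obtain ⟨m, hm⟩ := exists_linearMap_mapL
    ((LinearMap.mul ℂ D).compl₁₂ θ.toLinearMap θ'.toLinearMap)
  have hmc : Continuous m := m.continuous_of_finiteDimensional
  let ρ' : CStarTensor C S →ₗ[ℂ] (E ⊗[ℂ] F →L[ℂ] E ⊗[ℂ] F) :=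
    (ρ : CStarTensor C S →ₐ[ℂ] (E ⊗[ℂ] F →L[ℂ] E ⊗[ℂ] F)).toLinearMap
  let σ' : CStarTensor C S →ₗ[ℂ] D := (σ : CStarTensor C S →ₐ[ℂ] D).toLinearMap
  have hρc : Continuous ρ := StarAlgHom.continuous_of_cstar (A := CStarTensor C S)
    (D := E ⊗[ℂ] F →L[ℂ] E ⊗[ℂ] F) ρ
  have hσc : Continuous σ := σ.continuous_of_cstar
  have hcl : IsClosed {x | m (ρ x) = σ x} := isClosed_eq (hmc.comp hρc) hσc
  -- On elementary tensors `σ` is `θ (z c) * θ' (w s)`, which is `m` applied to `z c ⊗ w s`;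
  -- continuity extends this to all `x`. Hence `ker ρ ⊆ ker σ`, and simplicity of the operators on
  -- `E ⊗ F` gives the converse.
  have hfac : ∀ x, m (ρ x) = σ x := CStarTensor.mem_of_isClosed
    (M := LinearMap.eqLocus (m ∘ₗ ρ') σ') hcl fun c s => by
      change m (ρ (CStarTensor.tmul c s)) = σ (CStarTensor.tmul c s)
      rw [hρ, hm, ← CStarTensor.inl_mul_inr, map_mul]
      exact (congrArg₂ (· * ·) (hθ c) (hθ' s)).symm
  obtain ⟨τ, hτ, hστ⟩ := exists_factor (tensorRep_surjective hz hw hρ)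
    (σ : CStarTensor C S →ₐ[ℂ] D) (fun x hx => by
      change σ x = 0
      rw [← hfac, hx, map_zero])
  have : σ x = τ (ρ x) := hστ x
  rw [this, map_eq_zero_iff τ hτ]

end TensorRep

/-! ### Irreducible representations of `C ⊗ S` as tensor products -/

section Decomposition

variable {C : Type u} {S : Type v} [CStarAlgebra C] [CStarAlgebra S]
  {H : Type w} [NormedAddCommGroup H] [InnerProductSpace ℂ H] [CompleteSpace H]

theorem IsIrreducibleRep.eq_bot_or_eq_top_of_tensor {σ : CStarTensor C S →⋆ₐ[ℂ] (H →L[ℂ] H)}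
    (hσ : IsIrreducibleRep σ) {M : Submodule ℂ H} (hM : IsClosed (M : Set H))
    (h : ∀ c s, ∀ x ∈ M, σ (CStarTensor.tmul c s) x ∈ M) : M = ⊥ ∨ M = ⊤ := by
  refine hσ.eq_bot_or_eq_top M hM fun a x hx => ?_
  let N : Submodule ℂ (CStarTensor C S) := M.comap
    ((ContinuousLinearMap.apply ℂ H x).toLinearMap ∘ₗ
      (σ : CStarTensor C S →ₐ[ℂ] (H →L[ℂ] H)).toLinearMap)
  refine CStarTensor.mem_of_isClosed (M := N) ?_ (fun c s => h c s x hx) a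
  exact hM.preimage ((ContinuousLinearMap.apply ℂ H x).continuous.comp σ.continuous_of_cstar)

/-- The operators `σ (1 ⊗ s)` lie in the commutant of the restriction to `C`, so a subspace
invariant under the restriction and its commutant is invariant under `σ`. -/
theorem IsIrreducibleRep.isFactorRep_inl {σ : CStarTensor C S →⋆ₐ[ℂ] (H →L[ℂ] H)}
    (hσ : IsIrreducibleRep σ) : IsFactorRep (σ.comp (CStarTensor.inl C S)) := by
  intro M hM hinv hcomm
  refine hσ.eq_bot_or_eq_top_of_tensor hM fun c s x hx => ?_
  rw [← CStarTensor.inl_mul_inr, map_mul]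
  refine hinv c _ (hcomm _ (fun c => ?_) x hx)
  change σ (CStarTensor.inr C S s) * σ (CStarTensor.inl C S c) =
    σ (CStarTensor.inl C S c) * σ (CStarTensor.inr C S s)
  rw [← map_mul, ← map_mul, CStarTensor.inl_mul_inr, CStarTensor.inr_mul_inl]

theorem IsIrreducibleRep.isFactorRep_inr {σ : CStarTensor C S →⋆ₐ[ℂ] (H →L[ℂ] H)}
    (hσ : IsIrreducibleRep σ) : IsFactorRep (σ.comp (CStarTensor.inr C S)) := by
  intro M hM hinv hcomm
  refine hσ.eq_bot_or_eq_top_of_tensor hM fun c s x hx => ?_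
  rw [← CStarTensor.inr_mul_inl, map_mul]
  refine hinv s _ (hcomm _ (fun s => ?_) x hx)
  change σ (CStarTensor.inl C S c) * σ (CStarTensor.inr C S s) =
    σ (CStarTensor.inr C S s) * σ (CStarTensor.inl C S c)
  rw [← map_mul, ← map_mul, CStarTensor.inl_mul_inr, CStarTensor.inr_mul_inl]

/-- Each irreducible representation of `C ⊗ S` has the kernel of the tensor product of irreducible
representations of `C` and `S`. -/
theorem IsIrreducibleRep.exists_tensor {σ : CStarTensor C S →⋆ₐ[ℂ] (H →L[ℂ] H)}
    (hσ : IsIrreducibleRep σ) (hC : IsSubhomogeneous C) (hS : IsSubhomogeneous S) :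
    ∃ (k l : ℕ) (z : C →⋆ₐ[ℂ] (StdHilbert.{u} k →L[ℂ] StdHilbert.{u} k))
      (w : S →⋆ₐ[ℂ] (StdHilbert.{v} l →L[ℂ] StdHilbert.{v} l)),
      0 < k ∧ 0 < l ∧ Function.Surjective z ∧ Function.Surjective w ∧ FiniteDimensional ℂ H ∧
      Module.finrank ℂ H = k * l ∧ (∀ c, z c = 0 → σ (CStarTensor.inl C S c) = 0) ∧
      ∀ s, w s = 0 → σ (CStarTensor.inr C S s) = 0 := by
  have := hσ.nontrivial
  obtain ⟨k, z, hk, hz, hzσ⟩ := hσ.isFactorRep_inl.exists_surjective hC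
  obtain ⟨l, w, hl, hw, hwσ⟩ := hσ.isFactorRep_inr.exists_surjective hS
  have := nontrivial_stdHilbert.{u} hk
  have := nontrivial_stdHilbert.{v} hl
  obtain ⟨ρ, hρ⟩ := exists_tensorRep hz hw
  have hker := tensorRep_ker hz hw hρ σ hzσ hwσ
  obtain ⟨ξ, hξ⟩ := exists_ne (0 : H)
  -- As `σ` vanishes on `ker ρ`, its orbits are finite-dimensional, hence closed, and a nonzero one
  -- is all of `H`. Then `σ` and `ρ` are both surjective with the same kernel, so the operator
  -- algebras are isomorphic and comparing dimensions gives `(dim H) ^ 2 = (k * l) ^ 2`.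
  have hfin := StarAlgHom.finiteDimensional_orbit (π := σ) ρ (fun x => (hker x).1) ξ
  have htop : σ.orbit ξ = ⊤ := (hσ.eq_bot_or_eq_top _ (Submodule.closed_of_finiteDimensional _)
    fun a x hx => σ.apply_mem_orbit a hx).resolve_left fun h => hξ (by
      simpa [h] using σ.self_mem_orbit ξ)
  rw [htop] at hfin
  have hfinH : FiniteDimensional ℂ H := Submodule.topEquiv.finiteDimensional
  obtain ⟨θ, hθ, hσθ⟩ := exists_factor (tensorRep_surjective hz hw hρ)
    (σ : CStarTensor C S →ₐ[ℂ] (H →L[ℂ] H)) fun x => (hker x).1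
  have hθs : Function.Surjective θ := fun T => by
    obtain ⟨x, rfl⟩ := hσ.surjective T
    exact ⟨ρ x, (hσθ x).symm⟩
  have hrank := (LinearEquiv.ofBijective θ.toLinearMap ⟨hθ, hθs⟩).finrank_eq
  rw [finrank_endCLM, finrank_endCLM, Module.finrank_tensorProduct, finrank_stdHilbert,
    finrank_stdHilbert] at hrank
  exact ⟨k, l, z, w, hk, hl, hz, hw, hfinH,
    (Nat.pow_left_injective (n := 2) (by norm_num) hrank).symm, hzσ, hwσ⟩

end Decomposition

/-! ### The primitive ideals of a tensor product -/

section TensorPrim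

variable {C : Type u} {S : Type v} [CStarAlgebra C] [CStarAlgebra S]

/-- Pointwise continuity of a family of representations can be tested on elementary tensors. -/
theorem CStarTensor.continuous_of_tmul {X : Type*} [TopologicalSpace X] {D : Type*}
    [CStarAlgebra D] (ρ : X → CStarTensor C S →⋆ₐ[ℂ] D)
    (h : ∀ c s, Continuous fun p => ρ p (CStarTensor.tmul c s)) (x : CStarTensor C S) :
    Continuous fun p => ρ p x := by
  let M : Submodule ℂ (CStarTensor C S) :=
    { carrier := {x | Continuous fun p => ρ p x}
      add_mem' := fun {a b} ha hb => by
        simp only [Set.mem_ofPred_eq, map_add] at *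
        exact ha.add hb
      zero_mem' := by
        simp only [Set.mem_ofPred_eq, map_zero]
        exact continuous_const
      smul_mem' := fun r a ha => by
        simp only [Set.mem_ofPred_eq, map_smul] at *
        exact ha.const_smul r }
  have hM : IsClosed (M : Set (CStarTensor C S)) := by
    refine isClosed_of_closure_subset fun a ha => ?_
    change Continuous fun p => ρ p a
    -- Representations are contractive, so approximating `a` by `b` approximates `ρ p a` by `ρ p b`
    -- uniformly in `p`.
    refine continuous_of_uniform_approx_of_continuous fun U hU => ?_
    obtain ⟨ε, hε, hεU⟩ := Metric.mem_uniformity_dist.1 hU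
    obtain ⟨b, hb, hab⟩ := Metric.mem_closure_iff.1 ha ε hε
    refine ⟨fun p => ρ p b, hb, fun p => hεU ?_⟩
    rw [dist_eq_norm, ← map_sub]
    refine (NonUnitalStarAlgHom.norm_apply_le (ρ p) _).trans_lt ?_
    rwa [← dist_eq_norm]
  exact CStarTensor.mem_of_isClosed hM h x

theorem continuous_mapL {E F : Type*} [NormedAddCommGroup E] [InnerProductSpace ℂ E]
    [NormedAddCommGroup F] [InnerProductSpace ℂ F] :
    Continuous fun p : (E →L[ℂ] E) × (F →L[ℂ] F) => TensorProduct.mapL p.1 p.2 := by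
  have h : IsBoundedBilinearMap ℂ fun p : (E →L[ℂ] E) × (F →L[ℂ] F) =>
      TensorProduct.mapL p.1 p.2 :=
    { add_left := fun _ _ _ => TensorProduct.mapL_add_left _ _ _
      smul_left := fun _ _ _ => TensorProduct.mapL_smul_left _ _ _
      add_right := fun _ _ _ => TensorProduct.mapL_add_right _ _ _
      smul_right := fun _ _ _ => TensorProduct.mapL_smul_right _ _ _
      bound := ⟨1, one_pos, fun T U => by
        rw [one_mul]
        exact TensorProduct.norm_mapL_le T U⟩ }
  exact h.continuous

theorem Continuous.mapL {X E F : Type*} [TopologicalSpace X] [NormedAddCommGroup E]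
    [InnerProductSpace ℂ E] [NormedAddCommGroup F] [InnerProductSpace ℂ F] {f : X → E →L[ℂ] E}
    {g : X → F →L[ℂ] F} (hf : Continuous f) (hg : Continuous g) :
    Continuous fun x => TensorProduct.mapL (f x) (g x) := by
  have h := (continuous_mapL (E := E) (F := F)).comp (hf.prodMk hg)
  exact h

theorem mapL_zero_left {E F : Type*} [NormedAddCommGroup E] [InnerProductSpace ℂ E]
    [NormedAddCommGroup F] [InnerProductSpace ℂ F] (U : F →L[ℂ] F) :
    TensorProduct.mapL (0 : E →L[ℂ] E) U = 0 := by
  ext x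
  simp

theorem mapL_zero_right {E F : Type*} [NormedAddCommGroup E] [InnerProductSpace ℂ E]
    [NormedAddCommGroup F] [InnerProductSpace ℂ F] (T : E →L[ℂ] E) :
    TensorProduct.mapL T (0 : F →L[ℂ] F) = 0 := by
  ext x
  simp

theorem mapL_one_right_eq_zero {E F : Type*} [NormedAddCommGroup E] [InnerProductSpace ℂ E]
    [NormedAddCommGroup F] [InnerProductSpace ℂ F] [Nontrivial F] {T : E →L[ℂ] E}
    (h : TensorProduct.mapL T (1 : F →L[ℂ] F) = 0) : T = 0 := by
  obtain ⟨y, hy⟩ := exists_ne (0 : F)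
  ext x
  have h1 : T x ⊗ₜ[ℂ] y = (0 : E ⊗[ℂ] F) :=
    congrArg (fun X : E ⊗[ℂ] F →L[ℂ] E ⊗[ℂ] F => X (x ⊗ₜ y)) h
  have h2 := congrArg norm h1
  rw [TensorProduct.norm_tmul, norm_zero, mul_eq_zero, norm_eq_zero, norm_eq_zero] at h2
  exact h2.resolve_right hy

theorem mapL_one_left_eq_zero {E F : Type*} [NormedAddCommGroup E] [InnerProductSpace ℂ E]
    [NormedAddCommGroup F] [InnerProductSpace ℂ F] [Nontrivial E] {U : F →L[ℂ] F}
    (h : TensorProduct.mapL (1 : E →L[ℂ] E) U = 0) : U = 0 := by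
  obtain ⟨x, hx⟩ := exists_ne (0 : E)
  ext y
  have h1 : x ⊗ₜ[ℂ] U y = (0 : E ⊗[ℂ] F) :=
    congrArg (fun X : E ⊗[ℂ] F →L[ℂ] E ⊗[ℂ] F => X (x ⊗ₜ y)) h
  have h2 := congrArg norm h1
  rw [TensorProduct.norm_tmul, norm_zero, mul_eq_zero, norm_eq_zero, norm_eq_zero] at h2
  exact h2.resolve_left hx

theorem primOfDim.exists_rep {A : Type u} [CStarAlgebra A] {d : ℕ} (P : primOfDim A d) :
    ∃ (H : Type u) (_ : NormedAddCommGroup H) (_ : InnerProductSpace ℂ H) (_ : CompleteSpace H)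
      (π : A →⋆ₐ[ℂ] (H →L[ℂ] H)), IsIrreducibleRep π ∧ FiniteDimensional ℂ H ∧
        ∀ a, a ∈ P.1.1 ↔ π a = 0 := by
  obtain ⟨P, H, _, _, _, π, hπ, hfin, -, hP⟩ := P
  exact ⟨H, _, _, _, π, hπ, hfin, fun a => by rw [← hP]; rfl⟩

/-- A primitive ideal of `C ⊗ S` is determined by primitive ideals of `C` and `S` that it
contains. -/
theorem primOfDim_tensor_ext {k l d : ℕ} {P : primOfDim C k} {Q : primOfDim S l}
    {R R' : primOfDim (CStarTensor C S) d}
    (hP : ∀ c ∈ P.1.1, CStarTensor.inl C S c ∈ R.1.1)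
    (hQ : ∀ s ∈ Q.1.1, CStarTensor.inr C S s ∈ R.1.1)
    (hP' : ∀ c ∈ P.1.1, CStarTensor.inl C S c ∈ R'.1.1)
    (hQ' : ∀ s ∈ Q.1.1, CStarTensor.inr C S s ∈ R'.1.1) : R = R' := by
  obtain ⟨E, _, _, _, z, hz, _, hPz⟩ := primOfDim.exists_rep P
  obtain ⟨F, _, _, _, w, hw, _, hQw⟩ := primOfDim.exists_rep Q
  obtain ⟨H, _, _, _, σ, hσ, _, hR⟩ := primOfDim.exists_rep R
  obtain ⟨H', _, _, _, σ', hσ', _, hR'⟩ := primOfDim.exists_rep R'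
  have := hz.nontrivial
  have := hw.nontrivial
  have := hσ.nontrivial
  have := hσ'.nontrivial
  obtain ⟨ρ, hρ⟩ := exists_tensorRep hz.surjective hw.surjective
  have h1 := tensorRep_ker hz.surjective hw.surjective hρ σ
    (fun c hc => (hR _).1 (hP c ((hPz c).2 hc))) (fun s hs => (hR _).1 (hQ s ((hQw s).2 hs)))
  have h2 := tensorRep_ker hz.surjective hw.surjective hρ σ'
    (fun c hc => (hR' _).1 (hP' c ((hPz c).2 hc))) (fun s hs => (hR' _).1 (hQ' s ((hQw s).2 hs)))
  exact Subtype.ext (Subtype.ext (Ideal.ext fun x => by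
    rw [hR, hR', ← h1, h2]))

/-- The tensor product of representations is continuous on pairs of surjective representations, and
its kernel depends only on the two kernels. So it descends to the primitive ideals, with `r` serving
as an arbitrary section of the quotient map. -/
theorem exists_tensorPrim_of_finrank {k l : ℕ} {E : Type u} [NormedAddCommGroup E]
    [InnerProductSpace ℂ E] [CompleteSpace E] [FiniteDimensional ℂ E] [Nontrivial E]
    {F : Type v} [NormedAddCommGroup F] [InnerProductSpace ℂ F] [CompleteSpace F]
    [FiniteDimensional ℂ F] [Nontrivial F] (hE : Module.finrank ℂ E = k)
    (hF : Module.finrank ℂ F = l) :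
    ∃ Φ : primOfDim C k × primOfDim S l → primOfDim (CStarTensor C S) (k * l),
      Continuous Φ ∧ (∀ p c, CStarTensor.inl C S c ∈ (Φ p).1.1 ↔ c ∈ p.1.1.1) ∧
        ∀ p s, CStarTensor.inr C S s ∈ (Φ p).1.1 ↔ s ∈ p.2.1.1 := by
  have hEF : Module.finrank ℂ (E ⊗[ℂ] F) = k * l := by
    rw [Module.finrank_tensorProduct, hE, hF]
  choose ρ hρ using fun p : irrSpace C E × irrSpace S F =>
    exists_tensorRep (z := (p.1.1 : C →⋆ₐ[ℂ] (E →L[ℂ] E)))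
      (w := (p.2.1 : S →⋆ₐ[ℂ] (F →L[ℂ] F))) p.1.2 p.2.2
  let T : irrSpace C E × irrSpace S F → irrSpace (CStarTensor C S) (E ⊗[ℂ] F) := fun p =>
    ⟨ρ p, tensorRep_surjective (z := (p.1.1 : C →⋆ₐ[ℂ] (E →L[ℂ] E)))
      (w := (p.2.1 : S →⋆ₐ[ℂ] (F →L[ℂ] F))) p.1.2 p.2.2 (hρ p)⟩
  have hρ' : ∀ p c s, ρ p (CStarTensor.tmul c s) =
      TensorProduct.mapL (p.1.1 c) (p.2.1 s) := hρ
  have hT : Continuous T := by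
    refine Continuous.subtype_mk (RepSpace.continuous_iff.2
      (CStarTensor.continuous_of_tmul (D := E ⊗[ℂ] F →L[ℂ] E ⊗[ℂ] F) ρ fun c s => ?_)) _
    have hcont₁ : Continuous fun p : irrSpace C E × irrSpace S F => p.1.1 c :=
      (RepSpace.continuous_apply c).comp (continuous_subtype_val.comp continuous_fst)
    have hcont₂ : Continuous fun p : irrSpace C E × irrSpace S F => p.2.1 s :=
      (RepSpace.continuous_apply s).comp (continuous_subtype_val.comp continuous_snd)
    simp only [hρ']
    exact (hcont₁.mapL hcont₂ :)
  let q : irrSpace C E × irrSpace S F → primOfDim C k × primOfDim S l :=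
    Prod.map (irrSpace.toPrim hE) (irrSpace.toPrim hF)
  have hqs : Function.Surjective q :=
    (irrSpace.toPrim_surjective hE).prodMap (irrSpace.toPrim_surjective hF)
  have hqp : IsProperMap q :=
    (irrSpace.isProperMap_toPrim hE).prodMap (irrSpace.isProperMap_toPrim hF)
  -- Products of quotient maps need not be quotient maps; here the product is one because both
  -- factors are proper.
  have hq : Topology.IsQuotientMap q := hqp.isClosedMap.isQuotientMap hqp.continuous hqs
  have hl' : ∀ p c, CStarTensor.inl C S c ∈ (irrSpace.toPrim hEF (T p)).1.1 ↔
      c ∈ (q p).1.1.1 := fun p c => by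
    change ρ p (CStarTensor.tmul c 1) = 0 ↔ p.1.1 c = 0
    rw [hρ', map_one]
    refine ⟨mapL_one_right_eq_zero, fun h => ?_⟩
    rw [h]
    exact mapL_zero_left _
  have hr' : ∀ p s, CStarTensor.inr C S s ∈ (irrSpace.toPrim hEF (T p)).1.1 ↔
      s ∈ (q p).2.1.1 := fun p s => by
    change ρ p (CStarTensor.tmul 1 s) = 0 ↔ p.2.1 s = 0
    rw [hρ', map_one]
    refine ⟨mapL_one_left_eq_zero, fun h => ?_⟩
    rw [h]
    exact mapL_zero_right _
  let r := Function.surjInv hqs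
  have hr : ∀ p, q (r p) = p := Function.surjInv_eq hqs
  refine ⟨fun p => irrSpace.toPrim hEF (T (r p)), ?_, fun p c => ?_, fun p s => ?_⟩
  · rw [hq.continuous_iff]
    have : (fun p => irrSpace.toPrim hEF (T (r p))) ∘ q = irrSpace.toPrim hEF ∘ T := by
      funext p
      refine primOfDim_tensor_ext (P := (q p).1) (Q := (q p).2) (fun c hc => ?_) (fun s hs => ?_)
        (fun c hc => (hl' p c).2 hc) (fun s hs => (hr' p s).2 hs)
      · refine (hl' (r (q p)) c).2 ?_
        rwa [hr]
      · refine (hr' (r (q p)) s).2 ?_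
        rwa [hr]
    rw [this]
    exact (irrSpace.continuous_toPrim hEF).comp hT
  · rw [hl', hr]
  · rw [hr', hr]

end TensorPrim

/-! ### The dimension of the primitive spectrum of a tensor product -/

section Dimension

theorem CoveringDimLE.of_isEmpty {X : Type*} [TopologicalSpace X] [IsEmpty X] (n : ℕ) :
    CoveringDimLE X n := fun 𝒰 hfin hop hc =>
  ⟨𝒰, hfin, hop, hc, fun V hV => ⟨V, hV, subset_rfl⟩, fun x => isEmptyElim x⟩

theorem CoveringDimLE.of_iUnion_countable {X : Type u} [TopologicalSpace X] [NormalSpace X]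
    {ι : Type*} [Countable ι] {F : ι → Set X} (hF : ∀ i, IsClosed (F i))
    (hFX : ⋃ i, F i = Set.univ) {n : ℕ} (h : ∀ i, CoveringDimLE (F i) n) : CoveringDimLE X n := by
  rcases isEmpty_or_nonempty ι with hι | hι
  · have : IsEmpty X := by
      rw [← Set.univ_eq_empty_iff, ← hFX, Set.iUnion_of_empty]
    exact .of_isEmpty n
  · obtain ⟨f, hf⟩ := exists_surjective_nat ι
    exact .of_iUnion (fun k => hF (f k)) (by rw [hf.iUnion_comp, hFX]) fun k => h (f k)

theorem CoveringDimLE.image {X : Type*} {Y : Type u} [TopologicalSpace X] [TopologicalSpace Y]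
    [T2Space Y] {f : X → Y} (hf : Continuous f) (hinj : Function.Injective f) {K : Set X}
    (hK : IsCompact K) {n : ℕ} (h : CoveringDimLE K n) : CoveringDimLE (f '' K) n := by
  have := isCompact_iff_compactSpace.1 hK
  let e : K ≃ f '' K := Equiv.Set.image f K hinj
  have he : Continuous e := (hf.comp continuous_subtype_val).subtype_mk _
  exact .of_isClosedEmbedding (he.homeoOfEquivCompactToT2 (f := e)).symm.isClosedEmbedding h

theorem CoveringDimLE.prod_set {X : Type u} {Y : Type v} [TopologicalSpace X] [TopologicalSpace Y]
    [T2Space X] [T2Space Y] {n m : ℕ} (hX : CoveringDimLE X n) (hY : CoveringDimLE Y m) {K : Set X}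
    (hK : IsCompact K) {L : Set Y} (hL : IsCompact L) :
    CoveringDimLE (K ×ˢ L : Set (X × Y)) (n + m) := by
  have := isCompact_iff_compactSpace.1 hK
  have := isCompact_iff_compactSpace.1 hL
  have h : CoveringDimLE (K × L) (n + m) := .prod
    (.of_isClosedEmbedding hK.isClosed.isClosedEmbedding_subtypeVal hX)
    (.of_isClosedEmbedding hL.isClosed.isClosedEmbedding_subtypeVal hY)
  exact .of_isClosedEmbedding (Homeomorph.Set.prod K L).isClosedEmbedding h

variable {C : Type u} {S : Type v} [CStarAlgebra C] [CStarAlgebra S]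

theorem exists_tensorPrim {k l d : ℕ} (h : k * l = d) (hk : (primOfDim C k).Nonempty)
    (hl : (primOfDim S l).Nonempty) :
    ∃ Φ : primOfDim C k × primOfDim S l → primOfDim (CStarTensor C S) d,
      Continuous Φ ∧ (∀ p c, CStarTensor.inl C S c ∈ (Φ p).1.1 ↔ c ∈ p.1.1.1) ∧
        ∀ p s, CStarTensor.inr C S s ∈ (Φ p).1.1 ↔ s ∈ p.2.1.1 := by
  subst h
  obtain ⟨P, hP⟩ := hk
  obtain ⟨Q, hQ⟩ := hl
  have := nontrivial_stdHilbert.{u} (pos_of_primOfDim ⟨P, hP⟩)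
  have := nontrivial_stdHilbert.{v} (pos_of_primOfDim ⟨Q, hQ⟩)
  exact exists_tensorPrim_of_finrank (finrank_stdHilbert.{u} k) (finrank_stdHilbert.{v} l)

/-- Each primitive ideal of `C ⊗ S` comes from primitive ideals of `C` and `S`. -/
theorem exists_primOfDim_of_tensor (hC : IsSubhomogeneous C) (hS : IsSubhomogeneous S) {d : ℕ}
    (R : primOfDim (CStarTensor C S) d) :
    ∃ (k l : ℕ) (P : primOfDim C k) (Q : primOfDim S l), k * l = d ∧
      (∀ c ∈ P.1.1, CStarTensor.inl C S c ∈ R.1.1) ∧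
        ∀ s ∈ Q.1.1, CStarTensor.inr C S s ∈ R.1.1 := by
  obtain ⟨R, H, _, _, _, σ, hσ, _, hd, hR⟩ := R
  obtain ⟨k, l, z, w, hk, hl, hz, hw, -, hkl, hzσ, hwσ⟩ := hσ.exists_tensor hC hS
  have := nontrivial_stdHilbert.{u} hk
  have := nontrivial_stdHilbert.{v} hl
  have hR' : ∀ x, x ∈ R.1 ↔ σ x = 0 := fun x => by rw [← hR]; rfl
  exact ⟨k, l, irrSpace.toPrim (finrank_stdHilbert k) ⟨z, hz⟩,
    irrSpace.toPrim (finrank_stdHilbert l) ⟨w, hw⟩, hkl.symm.trans hd,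
    fun c hc => (hR' _).2 (hzσ c hc), fun s hs => (hR' _).2 (hwσ s hs)⟩

/-- The maps `Φ` need only be continuous and injective: on products of compact pieces they are
homeomorphisms onto closed sets, and countably many such sets cover. -/
theorem coveringDimLE_primOfDim_tensor [TopologicalSpace.SeparableSpace C]
    [TopologicalSpace.SeparableSpace S] (hC : IsSubhomogeneous C) (hS : IsSubhomogeneous S)
    {d n : ℕ} (h : ∀ k l, k * l = d → (primOfDim C k).Nonempty → (primOfDim S l).Nonempty →
      ∃ a b, CoveringDimLE (primOfDim C k) a ∧ CoveringDimLE (primOfDim S l) b ∧ a + b ≤ n) :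
    CoveringDimLE (primOfDim (CStarTensor C S) d) n := by
  let I := {p : ℕ × ℕ // p.1 * p.2 = d ∧ (primOfDim C p.1).Nonempty ∧ (primOfDim S p.2).Nonempty}
  choose Φ hΦc hΦl hΦr using fun i : I => exists_tensorPrim i.2.1 i.2.2.1 i.2.2.2
  have hinj : ∀ i, Function.Injective (Φ i) := fun i p q hpq => by
    refine Prod.ext (Subtype.ext (Subtype.ext (Ideal.ext fun c => ?_)))
      (Subtype.ext (Subtype.ext (Ideal.ext fun s => ?_)))
    · rw [← hΦl, ← hΦl, hpq]
    · rw [← hΦr, ← hΦr, hpq]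
  let F : I × ℕ × ℕ → Set (primOfDim (CStarTensor C S) d) := fun j =>
    Φ j.1 '' (compactCovering (primOfDim C j.1.1.1) j.2.1 ×ˢ
      compactCovering (primOfDim S j.1.1.2) j.2.2)
  have hFc : ∀ j, IsCompact (F j) := fun j =>
    ((isCompact_compactCovering _ _).prod (isCompact_compactCovering _ _)).image (hΦc j.1)
  have hFX : ⋃ j, F j = Set.univ := by
    refine Set.eq_univ_of_forall fun R => ?_
    obtain ⟨k, l, P, Q, hkl, hP, hQ⟩ := exists_primOfDim_of_tensor hC hS R
    obtain ⟨a, ha⟩ := exists_mem_compactCovering P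
    obtain ⟨b, hb⟩ := exists_mem_compactCovering Q
    let i : I := ⟨(k, l), hkl, ⟨P.1, P.2⟩, ⟨Q.1, Q.2⟩⟩
    refine Set.mem_iUnion.2 ⟨(i, a, b), (P, Q), ⟨ha, hb⟩, ?_⟩
    exact primOfDim_tensor_ext (P := P) (Q := Q) (fun c hc => (hΦl i (P, Q) c).2 hc)
      (fun s hs => (hΦr i (P, Q) s).2 hs) hP hQ
  -- This supplies the normality that the sum theorem needs; the space is already known to be
  -- Hausdorff and locally compact.
  have : SigmaCompactSpace (primOfDim (CStarTensor C S) d) := by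
    rw [← isSigmaCompact_univ_iff, ← hFX]
    exact isSigmaCompact_iUnion _ fun j => (hFc j).isSigmaCompact
  refine .of_iUnion_countable (fun j => (hFc j).isClosed) hFX fun j => ?_
  obtain ⟨a, b, ha, hb, hab⟩ := h _ _ j.1.2.1 j.1.2.2.1 j.1.2.2.2
  exact (CoveringDimLE.image (hΦc j.1) (hinj j.1)
    ((isCompact_compactCovering _ _).prod (isCompact_compactCovering _ _))
    (ha.prod_set hb (isCompact_compactCovering _ _) (isCompact_compactCovering _ _))).mono hab

theorem IsSubhomogeneous.tensor (hC : IsSubhomogeneous C) (hS : IsSubhomogeneous S) :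
    IsSubhomogeneous (CStarTensor C S) := by
  obtain ⟨N, hN⟩ := id hC
  obtain ⟨M, hM⟩ := id hS
  refine ⟨N * M, fun H _ _ _ σ hσ => ?_⟩
  obtain ⟨k, l, z, w, hk, hl, hz, hw, hfin, hkl, -⟩ := hσ.exists_tensor hC hS
  have := nontrivial_stdHilbert.{u} hk
  have := nontrivial_stdHilbert.{v} hl
  have h1 := (hN _ z (isIrreducibleRep_of_surjective hz)).2
  have h2 := (hM _ w (isIrreducibleRep_of_surjective hw)).2
  rw [finrank_stdHilbert] at h1 h2
  exact ⟨hfin, hkl ▸ Nat.mul_le_mul h1 h2⟩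

theorem IrrepsDimGE.le_of_nonempty {J d : ℕ} (h : IrrepsDimGE C J) (hd : (primOfDim C d).Nonempty) :
    J ≤ d := by
  obtain ⟨P, H, _, _, _, π, hπ, _, rfl, -⟩ := hd
  have := h H π hπ
  rw [← Module.finrank_eq_rank] at this
  exact_mod_cast this

/-- After clearing denominators, `a * J ≤ x * k * l` uses `J ≤ l` and `b * J ≤ y * l * k` uses `J ≤
k`: each dimension is divided by the degree of the other factor. -/
theorem add_le_div_mul_of_div_le {x y : ℝ≥0∞} {a b k l J : ℕ} (hJ : 0 < J) (hk : J ≤ k)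
    (hl : J ≤ l) (ha : (a : ℝ≥0∞) / k ≤ x) (hb : (b : ℝ≥0∞) / l ≤ y) :
    ((a + b : ℕ) : ℝ≥0∞) ≤ (x + y) / J * (k * l : ℕ) := by
  have hJ0 : (J : ℝ≥0∞) ≠ 0 := by exact_mod_cast hJ.ne'
  have hk0 : (k : ℝ≥0∞) ≠ 0 := by exact_mod_cast (hJ.trans_le hk).ne'
  have hl0 : (l : ℝ≥0∞) ≠ 0 := by exact_mod_cast (hJ.trans_le hl).ne'
  have hkJ : (J : ℝ≥0∞) ≤ k := by exact_mod_cast hk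
  have hlJ : (J : ℝ≥0∞) ≤ l := by exact_mod_cast hl
  rw [ENNReal.div_le_iff hk0 (ENNReal.natCast_ne_top k)] at ha
  rw [ENNReal.div_le_iff hl0 (ENNReal.natCast_ne_top l)] at hb
  rw [← ENNReal.mul_div_right_comm, ENNReal.le_div_iff_mul_le (.inl hJ0)
    (.inl (ENNReal.natCast_ne_top J))]
  push_cast
  calc ((a : ℝ≥0∞) + b) * J = a * J + b * J := add_mul _ _ _
    _ ≤ x * k * l + y * l * k := by gcongr
    _ = (x + y) * (k * l) := by ring

theorem exists_coveringDim_eq_of_dimRatio_ne_top {A : Type u} [CStarAlgebra A]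
    (h : dimRatio A ≠ ⊤) {d : ℕ} (hd : (primOfDim A d).Nonempty) :
    ∃ n : ℕ, CoveringDimLE (primOfDim A d) n ∧ (n : ℝ≥0∞) / d ≤ dimRatio A := by
  have hle : (coveringDim (primOfDim A d) : ℝ≥0∞) / d ≤ dimRatio A :=
    le_iSup₂ (f := fun (d : ℕ) (_ : (primOfDim A d).Nonempty) =>
      (coveringDim (primOfDim A d) : ℝ≥0∞) / d) d hd
  have htop : coveringDim (primOfDim A d) ≠ ⊤ := fun h0 => h (by
    rw [h0, ENat.toENNReal_top, ENNReal.top_div_of_ne_top (ENNReal.natCast_ne_top d)] at hle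
    exact top_le_iff.1 hle)
  obtain ⟨n, hn⟩ := ENat.ne_top_iff_exists.1 htop
  refine ⟨n, coveringDimLE_of_coveringDim_eq hn.symm, ?_⟩
  rwa [← hn, ENat.toENNReal_coe] at hle

theorem dimRatio_tensor_le [TopologicalSpace.SeparableSpace C] [TopologicalSpace.SeparableSpace S]
    (hC : IsSubhomogeneous C) (hS : IsSubhomogeneous S) {J : ℕ} (hJ : 0 < J)
    (hCJ : IrrepsDimGE C J) (hSJ : IrrepsDimGE S J) :
    dimRatio (CStarTensor C S) ≤ (dimRatio C + dimRatio S) / J := by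
  refine iSup₂_le fun d hd => ?_
  by_cases htop : dimRatio C + dimRatio S = ⊤
  · rw [htop, ENNReal.top_div_of_ne_top (ENNReal.natCast_ne_top J)]
    exact le_top
  obtain ⟨hCt, hSt⟩ := ENNReal.add_ne_top.1 htop
  set r := (dimRatio C + dimRatio S) / J with hr
  have hJ0 : (J : ℝ≥0∞) ≠ 0 := by exact_mod_cast hJ.ne'
  have hrd : r * d ≠ ⊤ :=
    ENNReal.mul_ne_top (ENNReal.div_ne_top htop hJ0) (ENNReal.natCast_ne_top d)
  -- Covering dimension is bounded by natural numbers, so the real bound `r * d` is replaced by its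
  -- floor, which still dominates every integer sum `a + b`.
  have hdim : CoveringDimLE (primOfDim (CStarTensor C S) d) ⌊(r * d).toReal⌋₊ := by
    refine coveringDimLE_primOfDim_tensor hC hS fun k l hkl hk hl => ?_
    obtain ⟨a, ha, hak⟩ := exists_coveringDim_eq_of_dimRatio_ne_top hCt hk
    obtain ⟨b, hb, hbl⟩ := exists_coveringDim_eq_of_dimRatio_ne_top hSt hl
    refine ⟨a, b, ha, hb, Nat.le_floor ?_⟩
    have := add_le_div_mul_of_div_le hJ (hCJ.le_of_nonempty hk) (hSJ.le_of_nonempty hl) hak hbl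
    rw [hkl] at this
    have h2 := ENNReal.toReal_mono hrd this
    rwa [ENNReal.toReal_natCast] at h2
  refine ENNReal.div_le_of_le_mul ?_
  have h1 : coveringDim (primOfDim (CStarTensor C S) d) ≤ (⌊(r * d).toReal⌋₊ : ℕ∞) :=
    iInf₂_le _ hdim
  calc (coveringDim (primOfDim (CStarTensor C S) d) : ℝ≥0∞)
      ≤ ((⌊(r * d).toReal⌋₊ : ℕ∞) : ℝ≥0∞) := by exact_mod_cast h1
    _ = ENNReal.ofReal (⌊(r * d).toReal⌋₊ : ℝ) := by simp
    _ ≤ ENNReal.ofReal (r * d).toReal :=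
        ENNReal.ofReal_le_ofReal (Nat.floor_le ENNReal.toReal_nonneg)
    _ = r * d := ENNReal.ofReal_toReal hrd

end Dimension

end

theorem lemma5p3 {C : Type u} {S : Type v} [CStarAlgebra C] [CStarAlgebra S]
    [TopologicalSpace.SeparableSpace C] [TopologicalSpace.SeparableSpace S]
    (hC : IsSubhomogeneous C) (hS : IsSubhomogeneous S) (J : ℕ) (hJ : 0 < J)
    (hCJ : IrrepsDimGE C J) (hSJ : IrrepsDimGE S J) :
    IsSubhomogeneous (CStarTensor C S) ∧
      dimRatio (CStarTensor C S) ≤ (dimRatio C + dimRatio S) / J := by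
  exact ⟨hC.tensor hS, dimRatio_tensor_le hC hS hJ hCJ hSJ⟩
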